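/- Let $n=2^q$ with $q\ge 0$, let $m$ be a positive integer and let $U=(U_0,\dots,U_{n-1})$ be real $m\times m$ matrices such that the block-upper triangular block-Toeplitz matrix $\mathcal T(U)$ with first block row $[U_0,\dots,U_{n-1}]$ is a subgenerator (nonnegative off-diagonal entries, negative diagonal entries, nonpositive row sums). Let $\epsilon\in\mathbb C$ with $0<|\epsilon|<1$, let $\theta=\epsilon^{1/n}$ be an $n$-th root of $\epsilon$, and let $\mathcal C_\epsilon(X)$ denote the block-$\epsilon$-circulant matrix with first block row $X=(X_0,\dots,X_{n-1})$: its block in position $(i,j)$ is $X_{j-i}$ if $j\ge i$ and $\epsilon X_{n+j-i}$ if $j<i$. Let $Y=(Y_0,\dots,Y_{n-1})$ be the block vector with $\mathcal C_\epsilon(Y)=e^{\mathcal C_\epsilon(U)}$. With $\omega=e^{2\pi \mathrm i/n}$, $Y$ is computed in floating point arithmetic with machine precision $\mu$ by the algorithm $$Z_k=\theta^kU_k,\quad V_k=\sum_{h}\bar\omega^{kh}Z_h,\quad W_k=e^{V_k},\quad R_k=\frac1n\sum_h\omega^{kh}W_h,\quad Y_k=\theta^{-k}R_k\qquad(0\le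 k<n),$$ where both sums are evaluated entrywise by the radix-2 Cooley–Tukey FFT. Real operations return the rounded exact result, with relative error at most $\mu$ and without overflow or underflow; complex operations are carried out through real ones in the usual way. The powers $\theta^k$, $|k|<n$, are replaced by stored values with relative error at most $\mu$, the roots of unity in the FFT by stored values with absolute error at most $\mu$, and the exponentials of $m\times m$ matrices are computed with $\|\mathrm{fl}(e^V)-e^V\|_\infty\le\mu\tau\|e^V\|_\infty$ for a constant $\tau\ge 0$ independent of $\mu$. Let $\widehat Y_k$ be the computed value of $Y_k$ and $\Delta_{Y_k}=Y_k-\widehat Y_k$. Then, up to terms of higher order in $\mu$, $$\|\Delta_{Y_k}\|_\infty\le \mu\,|\epsilon|^{-1}m\,\varphi+O(\mu^2)\quad(\mu\to0),\qquad k=0,\dots,n-1,$$ $$\varphi=mn(\zeta+\gamma\log_2 n)\max_{r,s,h}|(U_h)_{r,s}|+(\zeta+\gamma\sqrt n\log_2 n)\max_h\|Y_h\|_\infty+\tau,\qquad \zeta=1+2\sqrt2,\quad\gamma=4\sqrt2+1,$$ where the constant in $O(\mu^2)$ may depend on $n,m,U,\epsilon,\theta,\tau$ but not on $\mu$, on the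 rounding, or on the stored approximations. -/

import Mathlib

noncomputable section

open scoped ComplexConjugate

/-! ## Subgenerators, block-Toeplitz and block-`ε`-circulant matrices -/

/-- A subgenerator: nonnegative off-diagonal entries, negative diagonal entries, nonpositive
row sums. -/
def IsSubgenerator {ι : Type*} [Fintype ι] (Q : Matrix ι ι ℝ) : Prop :=
  (∀ i j, i ≠ j → 0 ≤ Q i j) ∧ (∀ i, Q i i < 0) ∧ ∀ i, ∑ j, Q i j ≤ 0

/-- The block-upper triangular block-Toeplitz matrix with first block row `U`. An entry of a block
matrix is indexed by pairs (index of the block, index inside the block). -/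
def blockToeplitz {n m : ℕ} (U : Fin n → Matrix (Fin m) (Fin m) ℝ) :
    Matrix (Fin n × Fin m) (Fin n × Fin m) ℝ :=
  Matrix.of fun a b => if a.1 ≤ b.1 then U (b.1 - a.1) a.2 b.2 else 0

/-- The block-`ε`-circulant matrix with first block row `U`. The subtraction in `Fin n` is modulo
`n`, so the block in position `(i, j)` is `U_{j-i}` if `i ≤ j` and `ε U_{n+j-i}` if `j < i`. -/
def blockEpsCirculant {n m : ℕ} (ε : ℂ) (U : Fin n → Matrix (Fin m) (Fin m) ℂ) :
    Matrix (Fin n × Fin m) (Fin n × Fin m) ℂ :=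
  Matrix.of fun a b =>
    if a.1 ≤ b.1 then U (b.1 - a.1) a.2 b.2 else ε * U (b.1 - a.1) a.2 b.2

section
attribute [local instance] Matrix.linftyOpNormedAddCommGroup

/-- The matrix norm `‖A‖_∞` (maximal absolute row sum). -/
def normInf {m : ℕ} (A : Matrix (Fin m) (Fin m) ℂ) : ℝ := ‖A‖

end

/-! ## Floating point arithmetic -/

/-- A rounding map `x ↦ fl(x)` of relative precision `μ` (without overflow and underflow). The
floating point numbers are the numbers that are not changed by rounding, and the arithmetic
operations return the rounded value of the exact result. -/
structure Rounding (μ : ℝ) where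
  fl : ℝ → ℝ
  fl_fl : ∀ x, fl (fl x) = fl x
  abs_fl_sub_le : ∀ x, |fl x - x| ≤ μ * |x|

namespace Rounding

variable {μ : ℝ} (R : Rounding μ)

/-- Complex floating point numbers: pairs of real ones. -/
def IsFloat (x : ℂ) : Prop := R.fl x.re = x.re ∧ R.fl x.im = x.im

/-- Computed sum of two complex numbers. -/
def add (x y : ℂ) : ℂ := ⟨R.fl (x.re + y.re), R.fl (x.im + y.im)⟩

/-- Computed difference of two complex numbers. -/
def sub (x y : ℂ) : ℂ := ⟨R.fl (x.re - y.re), R.fl (x.im - y.im)⟩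

/-- Computed product of two complex numbers, by four real products and two real additions. -/
def mul (x y : ℂ) : ℂ :=
  ⟨R.fl (R.fl (x.re * y.re) - R.fl (x.im * y.im)),
   R.fl (R.fl (x.re * y.im) + R.fl (x.im * y.re))⟩

/-- Computed quotient of a complex number by a real number. -/
def divReal (x : ℂ) (a : ℝ) : ℂ := ⟨R.fl (x.re / a), R.fl (x.im / a)⟩

/-- The radix-2 Cooley-Tukey FFT of a vector of length `2 ^ q` in floating point arithmetic.
`w p j` is the stored value of the root of unity that multiplies the `j`-th entry in the step that
combines two transforms of length `2 ^ p` into one of length `2 ^ (p + 1)`. -/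
def fft (w : ℕ → ℕ → ℂ) : (q : ℕ) → (Fin (2 ^ q) → ℂ) → Fin (2 ^ q) → ℂ
  | 0, x => x
  | q + 1, x =>
    let even : Fin (2 ^ q) → ℂ := fft w q fun i => x ⟨2 * i.1, by have := i.2; omega⟩
    let odd : Fin (2 ^ q) → ℂ := fft w q fun i => x ⟨2 * i.1 + 1, by have := i.2; omega⟩
    fun j =>
      if h : j.1 < 2 ^ q then
        R.add (even ⟨j.1, h⟩) (R.mul (w q j.1) (odd ⟨j.1, h⟩))
      else
        have h' : j.1 - 2 ^ q < 2 ^ q := by have := j.2; omega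
        R.sub (even ⟨j.1 - 2 ^ q, h'⟩) (R.mul (w q (j.1 - 2 ^ q)) (odd ⟨j.1 - 2 ^ q, h'⟩))

/-- The procedure `expm` computes the exponential of `V` with relative error `τ μ`, and returns
a matrix of floating point numbers. -/
def ExpmAccurateAt {m : ℕ} (τ : ℝ)
    (expm : Matrix (Fin m) (Fin m) ℂ → Matrix (Fin m) (Fin m) ℂ)
    (V : Matrix (Fin m) (Fin m) ℂ) : Prop :=
  (∀ r s, R.IsFloat (expm V r s)) ∧
    normInf (expm V - NormedSpace.exp V) ≤ μ * τ * normInf (NormedSpace.exp V)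

/-- Steps 1 and 2 of the algorithm in floating point arithmetic: `Z = D_ε U`, `V = F^H Z`.
`t k` is the stored value of `θ ^ k`, where `θ = ε^{1/n}`; the transform `F^H` is the FFT with
the conjugate roots of unity. -/
def algV {q m : ℕ} (w : ℕ → ℕ → ℂ) (t : ℤ → ℂ) (U : Fin (2 ^ q) → Matrix (Fin m) (Fin m) ℂ)
    (k : Fin (2 ^ q)) : Matrix (Fin m) (Fin m) ℂ :=
  Matrix.of fun r s =>
    R.fft (fun p j => conj (w p j)) q (fun h => R.mul (t (h.1 : ℤ)) (U h r s)) k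

/-- The output of the algorithm in floating point arithmetic: after steps 1 and 2,
`W_k = e^{V_k}` by the procedure `expm`, then `R = (1/n) F W` and `Y = D_ε⁻¹ R`. -/
def algY {q m : ℕ} (w : ℕ → ℕ → ℂ) (t : ℤ → ℂ)
    (expm : Matrix (Fin m) (Fin m) ℂ → Matrix (Fin m) (Fin m) ℂ)
    (U : Fin (2 ^ q) → Matrix (Fin m) (Fin m) ℂ) (k : Fin (2 ^ q)) :
    Matrix (Fin m) (Fin m) ℂ :=
  Matrix.of fun r s =>
    R.mul (t (-(k.1 : ℤ)))
      (R.divReal (R.fft w q (fun h => expm (R.algV w t U h) r s) k) (2 ^ q))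

end Rounding

/-- The stored roots of unity `w p j ≈ ω^j`, `ω = exp(2πi / 2^(p+1))`, that are used by an FFT of
length `2 ^ q` have error at most `μ`. -/
def ApproxRoots (μ : ℝ) (q : ℕ) (w : ℕ → ℕ → ℂ) : Prop :=
  ∀ p < q, ∀ j < 2 ^ p,
    ‖w p j - Complex.exp (2 * Real.pi * Complex.I * j / (2 ^ (p + 1) : ℂ))‖ ≤ μ

/-- The stored powers `t k = θ ^ k (1 + σ_k)`, `-n < k < n`, have relative error `|σ_k| ≤ μ`. -/
def ApproxPowers (μ : ℝ) (n : ℕ) (θ : ℂ) (t : ℤ → ℂ) : Prop :=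
  ∀ k : ℤ, |k| < n → ‖t k - θ ^ k‖ ≤ μ * ‖θ ^ k‖

/-- `ζ = 1 + 2√2`. -/
def zetaConst : ℝ := 1 + 2 * √2

/-- `γ = 4√2 + 1`. -/
def gammaConst : ℝ := 4 * √2 + 1

/-- `φ = m n (ζ + γ log₂ n) max |U| + (ζ + γ √n log₂ n) max ‖Y‖ + τ`. -/
def phi (m n : ℕ) (maxU maxY τ : ℝ) : ℝ :=
  m * n * (zetaConst + gammaConst * Real.logb 2 n) * maxU
    + (zetaConst + gammaConst * √n * Real.logb 2 n) * maxY + τ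

end

noncomputable section

open scoped ComplexConjugate

/-! ## Diagonalization of block-`ε`-circulant matrices -/

/-! Scaling by powers of `θ` followed by a Fourier transform block-diagonalizes every
block-`ε`-circulant matrix (`blockEpsCirculant_circulantRow`). Exponentiating the diagonal blocks
and transforming back therefore gives `Y` exactly (`blockEpsCirculant_exp`), and it remains to
follow the rounding errors through the five stages.

The FFT is stable in the Euclidean norm: each butterfly step is `√2` times an isometry, so relative
errors compound by one factor `1 + butterflyErr μ` per level (`twoNorm_fft_sub_dft_le`). Since `‖θ‖
≤ 1`, this bounds the error of each diagonal block by about `m n max|U| · O(μ log n)`.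

The exponential does not amplify this error. The subgenerator property gives, for each block `V`, a
shift `c` with `‖V + c‖ ≤ c`; hence `‖e^V‖ ≤ 1` and `‖e^B - e^V‖ ≤ ‖B - V‖ exp ‖B - V‖`, with no
dependence on `‖V‖`.

In the inverse transform the error inherited from the exponentials is only averaged. The new
rounding error is relative to the size of `W`, which Parseval's identity bounds through the blocks
`θ^k Y_k`; this produces `√n max‖Y‖`. The final scaling costs at most `|ε|⁻¹`.

All this gives an explicit bound `outErr`, a smooth function of `μ` vanishing at `0`. Taylor's
formula and a comparison of its derivative at `0` with `phi` finish the proof. -/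

theorem exp_pi {𝔸 ι : Type*} [NormedRing 𝔸] [NormedAlgebra ℂ 𝔸] [CompleteSpace 𝔸] [Finite ι]
    (V : ι → 𝔸) : NormedSpace.exp V = fun h => NormedSpace.exp (V h) := by
  let _ : NormedAlgebra ℚ 𝔸 := .restrictScalars ℚ ℂ 𝔸
  exact Pi.exp_def V

section
attribute [local instance] Matrix.linftyOpNormedRing Matrix.linftyOpNormedAlgebra

theorem completeSpace_linftyOp (m : ℕ) : @CompleteSpace (Matrix (Fin m) (Fin m) ℂ)
    Matrix.linftyOpNormedRing.toMetricSpace.toPseudoMetricSpace.toUniformSpace :=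
  FiniteDimensional.complete ℂ _

end

section Circulant

variable {n m : ℕ}

/-- The first block row of the block-`ε`-circulant matrix with diagonal blocks `V`, in the basis
given by the powers of `ω` and of `θ`. -/
def circulantRow (ω θ : ℂ) (V : Fin n → Matrix (Fin m) (Fin m) ℂ) (k : Fin n) :
    Matrix (Fin m) (Fin m) ℂ :=
  (θ⁻¹ ^ k.1 * (n : ℂ)⁻¹) • ∑ h : Fin n, ω ^ (k.1 * h.1) • V h

/-- The diagonal blocks of the block-`ε`-circulant matrix with first block row `U`. -/
def circulantSpectrum (ω θ : ℂ) (U : Fin n → Matrix (Fin m) (Fin m) ℂ) (k : Fin n) :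
    Matrix (Fin m) (Fin m) ℂ :=
  ∑ h : Fin n, ω⁻¹ ^ (k.1 * h.1) • θ ^ h.1 • U h

/-- The matrix whose columns are the block eigenvectors of block-`ε`-circulant matrices. -/
def circulantBasis (n m : ℕ) (ω θ : ℂ) : Matrix (Fin n × Fin m) (Fin m × Fin n) ℂ :=
  Matrix.of fun a b => if a.2 = b.1 then θ ^ a.1.1 * ω⁻¹ ^ (a.1.1 * b.2.1) else 0

/-- The inverse of `circulantBasis`. -/
def circulantBasisInv (n m : ℕ) (ω θ : ℂ) : Matrix (Fin m × Fin n) (Fin n × Fin m) ℂ :=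
  Matrix.of fun b a =>
    if b.1 = a.2 then (n : ℂ)⁻¹ * (θ⁻¹ ^ a.1.1 * ω ^ (a.1.1 * b.2.1)) else 0

/-- A geometric sum with ratio `z = ω^(i-j)`: `z ^ n = 1`, and `z = 1` only for `i = j` because `ω`
is primitive. -/
theorem sum_pow_mul_inv_pow {ω : ℂ} (hω : IsPrimitiveRoot ω n) (i j : Fin n) :
    ∑ k : Fin n, ω ^ (i.1 * k.1) * ω⁻¹ ^ (j.1 * k.1) = if i = j then (n : ℂ) else 0 := by
  have hn : n ≠ 0 := by have := i.2; omega
  have hω0 : ω ≠ 0 := hω.ne_zero hn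
  set z : ℂ := ω ^ i.1 * ω⁻¹ ^ j.1 with hz
  have h1 : ∀ k : ℕ, ω ^ (i.1 * k) * ω⁻¹ ^ (j.1 * k) = z ^ k := by
    intro k; rw [hz, mul_pow, ← pow_mul, ← pow_mul]
  simp only [h1]
  rw [Fin.sum_univ_eq_sum_range (fun k => z ^ k) n]
  split_ifs with h
  · subst h
    have : z = 1 := by rw [hz, ← mul_pow, mul_inv_cancel₀ hω0, one_pow]
    simp [this]
  · have hz1 : z ≠ 1 := by
      intro hz1
      apply h
      apply Fin.ext
      apply hω.pow_inj i.2 j.2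
      rw [hz, inv_pow] at hz1
      field_simp at hz1
      exact hz1
    have hzn : z ^ n = 1 := by
      rw [hz, mul_pow, ← pow_mul, ← pow_mul, mul_comm i.1, mul_comm j.1, pow_mul, pow_mul,
        inv_pow, hω.pow_eq_one]
      simp
    have := geom_sum_mul z n
    rw [hzn, sub_self] at this
    exact (mul_eq_zero.mp this).resolve_right (sub_ne_zero.mpr hz1)

/-- Fourier inversion. It shows that every block row comes from a spectrum, so the diagonalization
below applies to an arbitrary `U`. -/
theorem circulantRow_circulantSpectrum {ω θ : ℂ} (hω : IsPrimitiveRoot ω n) (hθ : θ ≠ 0)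
    (U : Fin n → Matrix (Fin m) (Fin m) ℂ) :
    circulantRow ω θ (circulantSpectrum ω θ U) = U := by
  funext k
  have hn : (n : ℂ) ≠ 0 := by
    have := k.2
    exact_mod_cast (by omega : n ≠ 0)
  simp only [circulantRow, circulantSpectrum, Finset.smul_sum]
  rw [Finset.sum_comm]
  have h1 : ∀ h : Fin n, ∑ x : Fin n, (θ⁻¹ ^ k.1 * (n : ℂ)⁻¹) • ω ^ (k.1 * x.1) •
      ω⁻¹ ^ (x.1 * h.1) • θ ^ h.1 • U h =
      (θ⁻¹ ^ k.1 * (n : ℂ)⁻¹ * (if k = h then (n : ℂ) else 0) * θ ^ h.1) • U h := by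
    intro h
    rw [← sum_pow_mul_inv_pow hω, Finset.mul_sum, Finset.sum_mul, Finset.sum_smul]
    refine Finset.sum_congr rfl fun x _ => ?_
    rw [smul_smul, smul_smul, smul_smul, mul_comm x.1 h.1]
    congr 1
    ring
  simp only [h1]
  rw [Finset.sum_eq_single k]
  · rw [if_pos rfl]
    have : θ⁻¹ ^ k.1 * (n : ℂ)⁻¹ * n * θ ^ k.1 = 1 := by
      rw [mul_assoc _ _ (n : ℂ), inv_mul_cancel₀ hn, mul_one, ← mul_pow, inv_mul_cancel₀ hθ,
        one_pow]
    rw [this, one_smul]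
  · intro b _ hb
    rw [if_neg (Ne.symm hb)]
    simp
  · simp

theorem circulantBasisInv_mul_circulantBasis {ω θ : ℂ} (hω : IsPrimitiveRoot ω n) (hθ : θ ≠ 0) :
    circulantBasisInv n m ω θ * circulantBasis n m ω θ = 1 := by
  ext ⟨r, h⟩ ⟨s, k⟩
  have hn : (n : ℂ) ≠ 0 := by
    have := k.2
    exact_mod_cast (by omega : n ≠ 0)
  have hL : (circulantBasisInv n m ω θ * circulantBasis n m ω θ) (r, h) (s, k) =
      if r = s then ∑ x : Fin n, (n : ℂ)⁻¹ * (θ⁻¹ ^ x.1 * ω ^ (x.1 * h.1)) *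
        (θ ^ x.1 * ω⁻¹ ^ (x.1 * k.1)) else 0 := by
    simp only [Matrix.mul_apply, circulantBasisInv, circulantBasis, Matrix.of_apply,
      Fintype.sum_prod_type, ite_mul, mul_ite, mul_zero, zero_mul]
    split_ifs with hrs
    · subst hrs; simp
    · refine Finset.sum_eq_zero fun x _ => Finset.sum_eq_zero fun y _ => ?_
      split_ifs with h1 h2
      · exact absurd (h2.trans h1) hrs
      all_goals rfl
  rw [hL]
  by_cases hrs : r = s
  · subst hrs
    rw [if_pos rfl]
    have h1 : ∀ x : Fin n, (n : ℂ)⁻¹ * (θ⁻¹ ^ x.1 * ω ^ (x.1 * h.1)) *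
        (θ ^ x.1 * ω⁻¹ ^ (x.1 * k.1)) = (n : ℂ)⁻¹ * (ω ^ (h.1 * x.1) * ω⁻¹ ^ (k.1 * x.1)) := by
      intro x
      have : θ⁻¹ ^ x.1 * θ ^ x.1 = 1 := by rw [← mul_pow, inv_mul_cancel₀ hθ, one_pow]
      rw [mul_comm x.1 h.1, mul_comm x.1 k.1]
      linear_combination ((n : ℂ)⁻¹ * (ω ^ (h.1 * x.1) * ω⁻¹ ^ (k.1 * x.1))) * this
    simp only [h1]
    rw [← Finset.mul_sum, sum_pow_mul_inv_pow hω]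
    by_cases hhk : h = k
    · subst hhk; simp [hn]
    · rw [Matrix.one_apply_ne (by simp [hhk])]; simp [hhk]
  · rw [Matrix.one_apply_ne (by simp [hrs])]
    simp [hrs]

theorem circulantBasis_mul_circulantBasisInv {ω θ : ℂ} (hω : IsPrimitiveRoot ω n) (hθ : θ ≠ 0) :
    circulantBasis n m ω θ * circulantBasisInv n m ω θ = 1 :=
  (Matrix.mul_eq_one_comm_of_equiv (Equiv.prodComm (Fin m) (Fin n))).mp
    (circulantBasisInv_mul_circulantBasis hω hθ)

theorem blockEpsCirculant_circulantRow {ω θ : ℂ} (hω : IsPrimitiveRoot ω n) (hθ : θ ≠ 0)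
    (V : Fin n → Matrix (Fin m) (Fin m) ℂ) :
    blockEpsCirculant (θ ^ n) (circulantRow ω θ V) =
      circulantBasis n m ω θ * Matrix.blockDiagonal V * circulantBasisInv n m ω θ := by
  ext ⟨i, r⟩ ⟨j, s⟩
  have hn : n ≠ 0 := by have := i.2; omega
  have hω0 : ω ≠ 0 := hω.ne_zero hn
  have hR : (circulantBasis n m ω θ * Matrix.blockDiagonal V * circulantBasisInv n m ω θ)
      (i, r) (j, s) = ∑ h : Fin n, θ ^ i.1 * ω⁻¹ ^ (i.1 * h.1) * V h r s *
        ((n : ℂ)⁻¹ * (θ⁻¹ ^ j.1 * ω ^ (j.1 * h.1))) := by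
    simp only [Matrix.mul_apply, circulantBasisInv, circulantBasis, Matrix.of_apply,
      Matrix.blockDiagonal_apply, Fintype.sum_prod_type_right, ite_mul, mul_ite, mul_zero,
      zero_mul, Finset.sum_ite_eq', Finset.mem_univ, if_true]
    refine Finset.sum_congr rfl fun h _ => ?_
    congr 1
    rw [Finset.sum_eq_single h]
    · simp
    · intro b _ hb; simp [hb]
    · simp
  rw [hR]
  have hL : ∀ k : Fin n, circulantRow ω θ V k r s =
      ∑ h : Fin n, θ⁻¹ ^ k.1 * (n : ℂ)⁻¹ * (ω ^ k.1) ^ h.1 * V h r s := by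
    intro k
    simp only [circulantRow, Matrix.smul_apply, Matrix.sum_apply, smul_eq_mul, Finset.mul_sum,
      pow_mul, mul_assoc]
  simp only [blockEpsCirculant, Matrix.of_apply, hL]
  split_ifs with hij
  · refine Finset.sum_congr rfl fun h _ => ?_
    rw [Fin.sub_val_of_le hij]
    have hij' : i.1 ≤ j.1 := hij
    obtain ⟨d, hd⟩ := Nat.exists_eq_add_of_le hij'
    rw [hd, Nat.add_sub_cancel_left, add_mul, pow_add, pow_add, pow_mul ω, pow_mul ω,
      pow_mul ω⁻¹]
    have h1 : θ ^ i.1 * θ⁻¹ ^ i.1 = 1 := by rw [← mul_pow, mul_inv_cancel₀ hθ, one_pow]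
    have h2 : (ω⁻¹ ^ i.1) ^ h.1 * (ω ^ i.1) ^ h.1 = 1 := by
      rw [← mul_pow, ← mul_pow, inv_mul_cancel₀ hω0, one_pow, one_pow]
    linear_combination (-(θ⁻¹ ^ d * (n : ℂ)⁻¹ * (ω ^ d) ^ h.1 * V h r s)) * h1 -
      (θ ^ i.1 * θ⁻¹ ^ i.1 * θ⁻¹ ^ d * (n : ℂ)⁻¹ * (ω ^ d) ^ h.1 * V h r s) * h2
  · rw [Finset.mul_sum]
    refine Finset.sum_congr rfl fun h _ => ?_
    have hji : j.1 < i.1 := not_le.mp hij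
    rw [Fin.coe_sub_iff_lt.mpr (not_le.mp hij)]
    obtain ⟨d, hd⟩ := Nat.exists_eq_add_of_le hji.le
    obtain ⟨e, he⟩ := Nat.exists_eq_add_of_le (by have := i.2; omega : d ≤ n)
    have h0 : n + j.1 - i.1 = e := by omega
    rw [h0, hd, add_mul, pow_add, pow_add, pow_mul ω, pow_mul ω⁻¹, pow_mul ω⁻¹]
    have h1 : θ ^ j.1 * θ⁻¹ ^ j.1 = 1 := by rw [← mul_pow, mul_inv_cancel₀ hθ, one_pow]
    have h2 : (ω⁻¹ ^ j.1) ^ h.1 * (ω ^ j.1) ^ h.1 = 1 := by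
      rw [← mul_pow, ← mul_pow, inv_mul_cancel₀ hω0, one_pow, one_pow]
    -- Below the diagonal the block index wraps around to `e = n - d`. The factor `ε = θ ^ n` is
    -- what turns `θ⁻¹ ^ e` into the required `θ ^ d`, while `ω ^ n = 1` handles the roots of unity.
    have h3 : θ ^ n * θ⁻¹ ^ e = θ ^ d := by
      rw [he, pow_add, mul_assoc, ← mul_pow, mul_inv_cancel₀ hθ, one_pow, mul_one]
    have h4 : (ω ^ e) ^ h.1 = (ω⁻¹ ^ d) ^ h.1 := by
      congr 1
      have : ω ^ d * ω ^ e = 1 := by rw [← pow_add, ← he, hω.pow_eq_one]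
      rw [inv_pow]
      exact eq_inv_of_mul_eq_one_right this
    rw [h4]
    linear_combination ((n : ℂ)⁻¹ * (ω⁻¹ ^ d) ^ h.1 * V h r s) * h3 -
      (θ ^ d * (n : ℂ)⁻¹ * (ω⁻¹ ^ d) ^ h.1 * V h r s) * h1 -
      (θ ^ d * θ ^ j.1 * θ⁻¹ ^ j.1 * (n : ℂ)⁻¹ * (ω⁻¹ ^ d) ^ h.1 * V h r s) * h2

section
attribute [local instance] Matrix.linftyOpNormedRing Matrix.linftyOpNormedAlgebra

/-- `A ↦ P * A * Q` is a continuous ring homomorphism, and these commute with `exp`. The form with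
two index types is needed because the eigenvector basis is indexed by `Fin n × Fin m` on one side
and `Fin m × Fin n` on the other. -/
theorem exp_mul_mul_of_mul_eq_one {ι κ : Type*} [Fintype ι] [Fintype κ] [DecidableEq ι]
    [DecidableEq κ] {P : Matrix ι κ ℂ} {Q : Matrix κ ι ℂ} (hQP : Q * P = 1) (hPQ : P * Q = 1)
    (A : Matrix κ κ ℂ) :
    NormedSpace.exp (P * A * Q) = P * NormedSpace.exp A * Q := by
  have hmul : ∀ A B : Matrix κ κ ℂ, P * (A * B) * Q = (P * A * Q) * (P * B * Q) := fun A B => by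
    have h : (P * A * Q) * (P * B * Q) = P * A * (Q * P) * (B * Q) := by
      simp only [Matrix.mul_assoc]
    rw [h, hQP, Matrix.mul_one]
    simp only [Matrix.mul_assoc]
  let f : Matrix κ κ ℂ →+* Matrix ι ι ℂ :=
    { toFun := fun A => P * A * Q
      map_one' := by rw [Matrix.mul_one]; exact hPQ
      map_mul' := hmul
      map_zero' := by simp
      map_add' := fun A B => by rw [Matrix.mul_add, Matrix.add_mul] }
  have hf : Continuous f :=
    (continuous_const.matrix_mul continuous_id).matrix_mul continuous_const
  exact (NormedSpace.map_exp f hf A).symm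

theorem blockEpsCirculant_exp {ω θ : ℂ} (hω : IsPrimitiveRoot ω n) (hθ : θ ≠ 0)
    (U : Fin n → Matrix (Fin m) (Fin m) ℂ) :
    blockEpsCirculant (θ ^ n)
        (circulantRow ω θ fun h => NormedSpace.exp (circulantSpectrum ω θ U h)) =
      NormedSpace.exp (blockEpsCirculant (θ ^ n) U) := by
  conv_rhs => rw [← circulantRow_circulantSpectrum hω hθ U]
  rw [blockEpsCirculant_circulantRow hω hθ, blockEpsCirculant_circulantRow hω hθ,
    exp_mul_mul_of_mul_eq_one (circulantBasisInv_mul_circulantBasis hω hθ)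
      (circulantBasis_mul_circulantBasisInv hω hθ), Matrix.exp_blockDiagonal]
  congr 3
  exact (@exp_pi (Matrix (Fin m) (Fin m) ℂ) (Fin n) Matrix.linftyOpNormedRing
    Matrix.linftyOpNormedAlgebra (completeSpace_linftyOp m) _ _).symm

end

end Circulant

/-! ## Perturbation of the exponential -/

section ExpPerturbation

variable {𝔸 : Type*} [NormedRing 𝔸]

theorem norm_pow_succ_sub_pow_succ_le [NormOneClass 𝔸] {A B : 𝔸} {M : ℝ}
    (hA : ‖A‖ ≤ M) (hB : ‖B‖ ≤ M) (k : ℕ) :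
    ‖B ^ (k + 1) - A ^ (k + 1)‖ ≤ (k + 1) * M ^ k * ‖B - A‖ := by
  have hM : 0 ≤ M := (norm_nonneg A).trans hA
  induction k with
  | zero => simp
  | succ k ih =>
    have h : B ^ (k + 1 + 1) - A ^ (k + 1 + 1) =
        B * (B ^ (k + 1) - A ^ (k + 1)) + (B - A) * A ^ (k + 1) := by
      rw [pow_succ' B (k + 1), pow_succ' A (k + 1)]; noncomm_ring
    rw [h]
    have h1 : ‖B * (B ^ (k + 1) - A ^ (k + 1))‖ ≤ M * ((k + 1) * M ^ k * ‖B - A‖) :=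
      (norm_mul_le _ _).trans (mul_le_mul hB ih (norm_nonneg _) hM)
    have h2 : ‖(B - A) * A ^ (k + 1)‖ ≤ ‖B - A‖ * M ^ (k + 1) :=
      (norm_mul_le _ _).trans (mul_le_mul_of_nonneg_left
        ((norm_pow_le A _).trans (pow_le_pow_left₀ (norm_nonneg _) hA _)) (norm_nonneg _))
    refine (norm_add_le _ _).trans ((add_le_add h1 h2).trans (le_of_eq ?_))
    push_cast
    ring

variable [NormedAlgebra ℂ 𝔸] [CompleteSpace 𝔸]

theorem hasSum_exp (A : 𝔸) :
    HasSum (fun k : ℕ => ((k.factorial : ℂ)⁻¹) • A ^ k) (NormedSpace.exp A) :=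
  NormedSpace.exp_series_hasSum_exp' (𝕂 := ℂ) A

theorem exp_eq_smul_exp_add (A : 𝔸) (c : ℝ) :
    NormedSpace.exp A = (Complex.exp (-c)) • NormedSpace.exp (A + algebraMap ℂ 𝔸 c) := by
  let _ : NormedAlgebra ℚ 𝔸 := .restrictScalars ℚ ℂ 𝔸
  rw [NormedSpace.exp_add_of_commute (Algebra.commutes (c : ℂ) A).symm,
    ← NormedSpace.algebraMap_exp_comm, ← Algebra.commutes, ← Algebra.smul_def, smul_smul,
    ← Complex.exp_eq_exp_ℂ, ← Complex.exp_add]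
  simp

variable [NormOneClass 𝔸]

/-- Compare the exponential series termwise. The constant terms cancel, and the factor `k + 1` from
the difference of powers reduces `1/(k+1)!` to `1/k!`, so the series of `exp M` reappears. -/
theorem norm_exp_sub_exp_le {A B : 𝔸} {M : ℝ} (hA : ‖A‖ ≤ M) (hB : ‖B‖ ≤ M) :
    ‖NormedSpace.exp B - NormedSpace.exp A‖ ≤ ‖B - A‖ * Real.exp M := by
  have h := (hasSum_exp B).sub (hasSum_exp A)
  have h' := (hasSum_nat_add_iff' 1).mpr h
  simp only [Finset.range_one, Finset.sum_singleton, pow_zero, sub_self, sub_zero] at h'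
  rw [← h'.tsum_eq]
  have hM : HasSum (fun k : ℕ => ‖B - A‖ * (M ^ k / (k.factorial : ℝ)))
      (‖B - A‖ * Real.exp M) := by
    refine HasSum.mul_left _ ?_
    rw [Real.exp_eq_exp_ℝ]
    exact NormedSpace.expSeries_div_hasSum_exp M
  refine tsum_of_norm_bounded hM fun k => ?_
  rw [← smul_sub, norm_smul]
  have hk : (0 : ℝ) < (k.factorial : ℝ) := by exact_mod_cast k.factorial_pos
  have h1 : ‖(((k + 1).factorial : ℂ))⁻¹‖ = ((k + 1) * (k.factorial : ℝ))⁻¹ := by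
    rw [norm_inv, Complex.norm_natCast, Nat.factorial_succ]; push_cast; ring
  rw [h1]
  calc ((k + 1) * (k.factorial : ℝ))⁻¹ * ‖B ^ (k + 1) - A ^ (k + 1)‖
      ≤ ((k + 1) * (k.factorial : ℝ))⁻¹ * ((k + 1) * M ^ k * ‖B - A‖) :=
        mul_le_mul_of_nonneg_left (norm_pow_succ_sub_pow_succ_le hA hB k) (by positivity)
    _ = _ := by field_simp

theorem norm_exp_le (A : 𝔸) : ‖NormedSpace.exp A‖ ≤ Real.exp ‖A‖ := by
  rw [← (hasSum_exp A).tsum_eq, Real.exp_eq_exp_ℝ]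
  refine tsum_of_norm_bounded (NormedSpace.expSeries_div_hasSum_exp ‖A‖) fun k => ?_
  rw [norm_smul, norm_inv, Complex.norm_natCast, div_eq_inv_mul]
  exact mul_le_mul_of_nonneg_left (norm_pow_le A k) (by positivity)

theorem norm_cexp_neg (c : ℝ) : ‖Complex.exp (-c)‖ = Real.exp (-c) := by
  rw [Complex.norm_exp]; simp

/-- If `V + c` has norm at most `c` (so that the logarithmic norm of `V` is nonpositive), then
`e ^ V` is a contraction. -/
theorem norm_exp_le_one {V : 𝔸} {c : ℝ} (h : ‖V + algebraMap ℂ 𝔸 c‖ ≤ c) :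
    ‖NormedSpace.exp V‖ ≤ 1 := by
  rw [exp_eq_smul_exp_add V c, norm_smul, norm_cexp_neg]
  calc _ ≤ Real.exp (-c) * Real.exp c := mul_le_mul_of_nonneg_left
        ((norm_exp_le _).trans (Real.exp_le_exp.mpr h)) (Real.exp_pos _).le
    _ = 1 := by rw [← Real.exp_add]; simp

/-- Shift both exponents by `c`. The shifted matrices have norm at most `c + ‖B - V‖`, and the
prefactor `exp (-c)` cancels the `exp c` in the general perturbation bound. -/
theorem norm_exp_sub_exp_le_of_contraction {V : 𝔸} {c : ℝ} (h : ‖V + algebraMap ℂ 𝔸 c‖ ≤ c)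
    (B : 𝔸) :
    ‖NormedSpace.exp B - NormedSpace.exp V‖ ≤ ‖B - V‖ * Real.exp ‖B - V‖ := by
  rw [exp_eq_smul_exp_add V c, exp_eq_smul_exp_add B c, ← smul_sub, norm_smul, norm_cexp_neg]
  have hB : ‖B + algebraMap ℂ 𝔸 c‖ ≤ c + ‖B - V‖ := by
    have : B + algebraMap ℂ 𝔸 c = (V + algebraMap ℂ 𝔸 c) + (B - V) := by abel
    rw [this]
    exact (norm_add_le _ _).trans (by gcongr)
  have := norm_exp_sub_exp_le (h.trans (le_add_of_nonneg_right (norm_nonneg (B - V)))) hB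
  rw [add_sub_add_right_eq_sub] at this
  calc _ ≤ Real.exp (-c) * (‖B - V‖ * Real.exp (c + ‖B - V‖)) :=
        mul_le_mul_of_nonneg_left this (Real.exp_pos _).le
    _ = ‖B - V‖ * Real.exp ‖B - V‖ := by
        rw [Real.exp_add, Real.exp_neg]
        field_simp

end ExpPerturbation

/-! ## The norm `‖·‖_∞` -/

section NormInf

attribute [local instance] Matrix.linftyOpNormedRing Matrix.linftyOpNormedAlgebra

variable {m : ℕ}

theorem normInf_nonneg (A : Matrix (Fin m) (Fin m) ℂ) : 0 ≤ normInf A :=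
  norm_nonneg (E := Matrix (Fin m) (Fin m) ℂ) A

theorem normInf_add_le (A B : Matrix (Fin m) (Fin m) ℂ) :
    normInf (A + B) ≤ normInf A + normInf B :=
  norm_add_le (E := Matrix (Fin m) (Fin m) ℂ) A B

theorem normInf_smul (c : ℂ) (A : Matrix (Fin m) (Fin m) ℂ) :
    normInf (c • A) = ‖c‖ * normInf A :=
  norm_smul (β := Matrix (Fin m) (Fin m) ℂ) c A

theorem normInf_sum_le {ι : Type*} (s : Finset ι) (A : ι → Matrix (Fin m) (Fin m) ℂ) :
    normInf (∑ i ∈ s, A i) ≤ ∑ i ∈ s, normInf (A i) :=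
  norm_sum_le (E := Matrix (Fin m) (Fin m) ℂ) s A

theorem normInf_le_iff {A : Matrix (Fin m) (Fin m) ℂ} {b : ℝ} (hb : 0 ≤ b) :
    normInf A ≤ b ↔ ∀ r, ∑ s, ‖A r s‖ ≤ b := by
  have h : normInf A = ((Finset.univ.sup fun r => ∑ s, ‖A r s‖₊ : NNReal) : ℝ) :=
    Matrix.linfty_opNorm_def A
  rw [h]
  lift b to NNReal using hb
  rw [NNReal.coe_le_coe, Finset.sup_le_iff]
  simp only [Finset.mem_univ, true_imp_iff, ← NNReal.coe_le_coe, NNReal.coe_sum, coe_nnnorm]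

theorem sum_norm_le_normInf (A : Matrix (Fin m) (Fin m) ℂ) (r : Fin m) :
    ∑ s, ‖A r s‖ ≤ normInf A :=
  (normInf_le_iff (normInf_nonneg A)).mp le_rfl r

theorem norm_apply_le_normInf (A : Matrix (Fin m) (Fin m) ℂ) (r s : Fin m) :
    ‖A r s‖ ≤ normInf A :=
  (Finset.single_le_sum (f := fun s => ‖A r s‖) (fun _ _ => norm_nonneg _)
    (Finset.mem_univ s)).trans (sum_norm_le_normInf A r)

theorem normInf_le_of_entries_le {A : Matrix (Fin m) (Fin m) ℂ} {b : ℝ} (hb : 0 ≤ b)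
    (h : ∀ r s, ‖A r s‖ ≤ b) : normInf A ≤ m * b := by
  rw [normInf_le_iff (by positivity)]
  intro r
  calc ∑ s, ‖A r s‖ ≤ ∑ _s : Fin m, b := Finset.sum_le_sum fun s _ => h r s
    _ = m * b := by simp

theorem normInf_le_mul_of_entries_le {A B : Matrix (Fin m) (Fin m) ℂ} {c : ℝ} (hc : 0 ≤ c)
    (h : ∀ r s, ‖A r s‖ ≤ c * ‖B r s‖) : normInf A ≤ c * normInf B := by
  rw [normInf_le_iff (mul_nonneg hc (normInf_nonneg B))]
  intro r
  calc ∑ s, ‖A r s‖ ≤ ∑ s, c * ‖B r s‖ := Finset.sum_le_sum fun s _ => h r s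
    _ = c * ∑ s, ‖B r s‖ := by rw [Finset.mul_sum]
    _ ≤ _ := mul_le_mul_of_nonneg_left (sum_norm_le_normInf B r) hc

theorem normInf_le_add_normInf_sub (A B : Matrix (Fin m) (Fin m) ℂ) :
    normInf A ≤ normInf B + normInf (A - B) := by
  simpa using normInf_add_le B (A - B)

theorem normInf_sub_le_add (A B C : Matrix (Fin m) (Fin m) ℂ) :
    normInf (A - C) ≤ normInf (A - B) + normInf (B - C) := by
  simpa using normInf_add_le (A - B) (B - C)

theorem normInf_sub_comm (A B : Matrix (Fin m) (Fin m) ℂ) :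
    normInf (A - B) = normInf (B - A) :=
  norm_sub_rev (E := Matrix (Fin m) (Fin m) ℂ) A B

theorem normInf_exp_le_one (hm : m ≠ 0) {V : Matrix (Fin m) (Fin m) ℂ} {c : ℝ}
    (h : normInf (V + algebraMap ℂ _ (c : ℂ)) ≤ c) : normInf (NormedSpace.exp V) ≤ 1 := by
  have : Nonempty (Fin m) := Fin.pos_iff_nonempty.mp (Nat.pos_of_ne_zero hm)
  exact @norm_exp_le_one (Matrix (Fin m) (Fin m) ℂ) Matrix.linftyOpNormedRing
    Matrix.linftyOpNormedAlgebra (completeSpace_linftyOp m) Matrix.linfty_opNormOneClass V c h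

theorem normInf_exp_sub_exp_le (hm : m ≠ 0) {V : Matrix (Fin m) (Fin m) ℂ} {c : ℝ}
    (h : normInf (V + algebraMap ℂ _ (c : ℂ)) ≤ c) (B : Matrix (Fin m) (Fin m) ℂ) :
    normInf (NormedSpace.exp B - NormedSpace.exp V) ≤
      normInf (B - V) * Real.exp (normInf (B - V)) := by
  have : Nonempty (Fin m) := Fin.pos_iff_nonempty.mp (Nat.pos_of_ne_zero hm)
  exact @norm_exp_sub_exp_le_of_contraction (Matrix (Fin m) (Fin m) ℂ) Matrix.linftyOpNormedRing
    Matrix.linftyOpNormedAlgebra (completeSpace_linftyOp m) Matrix.linfty_opNormOneClass V c h B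

end NormInf

/-! ## Complex floating point operations -/

theorem Complex.norm_le_mul_norm_of_abs_re_im_le {z w : ℂ} {c : ℝ} (hc : 0 ≤ c)
    (hre : |z.re| ≤ c * |w.re|) (him : |z.im| ≤ c * |w.im|) : ‖z‖ ≤ c * ‖w‖ := by
  refine le_of_sq_le_sq ?_ (by positivity)
  rw [mul_pow, Complex.sq_norm, Complex.sq_norm, Complex.normSq_apply, Complex.normSq_apply]
  have h1 := pow_le_pow_left₀ (abs_nonneg _) hre 2
  have h2 := pow_le_pow_left₀ (abs_nonneg _) him 2
  rw [mul_pow, sq_abs, sq_abs] at h1 h2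
  nlinarith

/-- Relative error of a complex product. -/
def mulErr (μ : ℝ) : ℝ := √2 * (2 * μ + μ ^ 2)

/-- Relative error of a complex product by a stored constant of relative error `μ`. -/
def storedMulErr (μ : ℝ) : ℝ := mulErr μ * (1 + μ) + μ

/-- Relative error of one step of the FFT. -/
def butterflyErr (μ : ℝ) : ℝ := μ + (1 + μ) * storedMulErr μ

theorem mulErr_nonneg {μ : ℝ} (hμ : 0 ≤ μ) : 0 ≤ mulErr μ := by unfold mulErr; positivity

theorem storedMulErr_nonneg {μ : ℝ} (hμ : 0 ≤ μ) : 0 ≤ storedMulErr μ := by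
  have := mulErr_nonneg hμ
  unfold storedMulErr; positivity

theorem butterflyErr_nonneg {μ : ℝ} (hμ : 0 ≤ μ) : 0 ≤ butterflyErr μ := by
  have := storedMulErr_nonneg hμ
  unfold butterflyErr; positivity

namespace Rounding

variable {μ : ℝ} (R : Rounding μ)

theorem fl_zero : R.fl 0 = 0 := by
  have := R.abs_fl_sub_le 0
  simpa using this

theorem norm_add_sub_le (hμ : 0 ≤ μ) (x y : ℂ) : ‖R.add x y - (x + y)‖ ≤ μ * ‖x + y‖ :=
  Complex.norm_le_mul_norm_of_abs_re_im_le hμ (R.abs_fl_sub_le _) (R.abs_fl_sub_le _)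

theorem norm_sub_sub_le (hμ : 0 ≤ μ) (x y : ℂ) : ‖R.sub x y - (x - y)‖ ≤ μ * ‖x - y‖ :=
  Complex.norm_le_mul_norm_of_abs_re_im_le hμ (R.abs_fl_sub_le _) (R.abs_fl_sub_le _)

theorem norm_divReal_sub_le (hμ : 0 ≤ μ) (x : ℂ) (a : ℝ) :
    ‖R.divReal x a - x / a‖ ≤ μ * ‖x / a‖ := by
  refine Complex.norm_le_mul_norm_of_abs_re_im_le hμ ?_ ?_
  · rw [Complex.sub_re, Complex.div_ofReal_re]; exact R.abs_fl_sub_le _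
  · rw [Complex.sub_im, Complex.div_ofReal_im]; exact R.abs_fl_sub_le _

theorem divReal_one {x : ℂ} (hx : R.IsFloat x) : R.divReal x 1 = x := by
  apply Complex.ext
  · simpa [divReal] using hx.1
  · simpa [divReal] using hx.2

/-- With a real factor the products by the zero imaginary part vanish, and the outer rounding acts
on already rounded numbers, so only one rounding per component remains. -/
theorem norm_mul_ofReal_sub_le (hμ : 0 ≤ μ) (x : ℂ) (u : ℝ) :
    ‖R.mul x u - x * u‖ ≤ μ * ‖x * u‖ := by
  have h1 : R.mul x u = ⟨R.fl (x.re * u), R.fl (x.im * u)⟩ := by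
    simp [mul, R.fl_zero, R.fl_fl]
  rw [h1]
  refine Complex.norm_le_mul_norm_of_abs_re_im_le hμ ?_ ?_
  · rw [Complex.sub_re, Complex.re_mul_ofReal]; exact R.abs_fl_sub_le _
  · rw [Complex.sub_im, Complex.im_mul_ofReal]; exact R.abs_fl_sub_le _

theorem abs_fl_fl_add_fl_sub_le (hμ : 0 ≤ μ) (a b : ℝ) :
    |R.fl (R.fl a + R.fl b) - (a + b)| ≤ (2 * μ + μ ^ 2) * (|a| + |b|) := by
  have h0 := R.abs_fl_sub_le (R.fl a + R.fl b)
  have h1 := R.abs_fl_sub_le a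
  have h2 := R.abs_fl_sub_le b
  have h3 : |R.fl a + R.fl b| ≤ (1 + μ) * (|a| + |b|) := by
    have : R.fl a + R.fl b = (a + b) + ((R.fl a - a) + (R.fl b - b)) := by ring
    rw [this]
    have := abs_add_le (a + b) ((R.fl a - a) + (R.fl b - b))
    have := abs_add_le a b
    have := abs_add_le (R.fl a - a) (R.fl b - b)
    linarith
  have h4 : R.fl (R.fl a + R.fl b) - (a + b) =
      (R.fl (R.fl a + R.fl b) - (R.fl a + R.fl b)) + ((R.fl a - a) + (R.fl b - b)) := by ring
  rw [h4]
  have h5 := abs_add_le (R.fl (R.fl a + R.fl b) - (R.fl a + R.fl b))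
    ((R.fl a - a) + (R.fl b - b))
  have h6 := abs_add_le (R.fl a - a) (R.fl b - b)
  have h7 := mul_le_mul_of_nonneg_left h3 hμ
  linarith

theorem abs_fl_fl_sub_fl_sub_le (hμ : 0 ≤ μ) (a b : ℝ) :
    |R.fl (R.fl a - R.fl b) - (a - b)| ≤ (2 * μ + μ ^ 2) * (|a| + |b|) := by
  have h0 := R.abs_fl_sub_le (R.fl a - R.fl b)
  have h1 := R.abs_fl_sub_le a
  have h2 := R.abs_fl_sub_le b
  have h3 : |R.fl a - R.fl b| ≤ (1 + μ) * (|a| + |b|) := by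
    have : R.fl a - R.fl b = (a - b) + ((R.fl a - a) - (R.fl b - b)) := by ring
    rw [this]
    have := abs_add_le (a - b) ((R.fl a - a) - (R.fl b - b))
    have := abs_sub a b
    have := abs_sub (R.fl a - a) (R.fl b - b)
    linarith
  have h4 : R.fl (R.fl a - R.fl b) - (a - b) =
      (R.fl (R.fl a - R.fl b) - (R.fl a - R.fl b)) + ((R.fl a - a) - (R.fl b - b)) := by ring
  rw [h4]
  have h5 := abs_add_le (R.fl (R.fl a - R.fl b) - (R.fl a - R.fl b))
    ((R.fl a - a) - (R.fl b - b))
  have h6 := abs_sub (R.fl a - a) (R.fl b - b)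
  have h7 := mul_le_mul_of_nonneg_left h3 hμ
  linarith

/-- By Cauchy–Schwarz the sum of moduli in each component is at most `‖x‖ * ‖y‖`; combining the two
components gives the factor `√2` in `mulErr`. -/
theorem norm_mul_sub_le (hμ : 0 ≤ μ) (x y : ℂ) :
    ‖R.mul x y - x * y‖ ≤ mulErr μ * (‖x‖ * ‖y‖) := by
  have hC : ∀ a b c d : ℝ, (|a * c| + |b * d|) ^ 2 ≤ (a ^ 2 + b ^ 2) * (c ^ 2 + d ^ 2) := by
    intro a b c d
    rw [abs_mul, abs_mul, ← sq_abs a, ← sq_abs b, ← sq_abs c, ← sq_abs d]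
    nlinarith [sq_nonneg (|a| * |d| - |b| * |c|)]
  have hk : 0 ≤ 2 * μ + μ ^ 2 := by positivity
  have hre := R.abs_fl_fl_sub_fl_sub_le hμ (x.re * y.re) (x.im * y.im)
  have him := R.abs_fl_fl_add_fl_sub_le hμ (x.re * y.im) (x.im * y.re)
  have hre2 := pow_le_pow_left₀ (abs_nonneg _) hre 2
  have him2 := pow_le_pow_left₀ (abs_nonneg _) him 2
  rw [sq_abs, mul_pow] at hre2 him2
  have h1 := mul_le_mul_of_nonneg_left (hC x.re x.im y.re y.im) (sq_nonneg (2 * μ + μ ^ 2))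
  have h2 := mul_le_mul_of_nonneg_left (hC x.re x.im y.im y.re) (sq_nonneg (2 * μ + μ ^ 2))
  have hE : 0 ≤ mulErr μ := mulErr_nonneg hμ
  refine le_of_sq_le_sq ?_ (by positivity)
  have h3 : (mulErr μ * (‖x‖ * ‖y‖)) ^ 2 = 2 * (2 * μ + μ ^ 2) ^ 2 *
      ((x.re ^ 2 + x.im ^ 2) * (y.re ^ 2 + y.im ^ 2)) := by
    rw [mul_pow, mul_pow, Complex.sq_norm, Complex.sq_norm, Complex.normSq_apply,
      Complex.normSq_apply, mulErr, mul_pow, Real.sq_sqrt (by norm_num)]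
    ring
  have h4 : ‖R.mul x y - x * y‖ ^ 2 =
      (R.fl (R.fl (x.re * y.re) - R.fl (x.im * y.im)) - (x.re * y.re - x.im * y.im)) ^ 2 +
      (R.fl (R.fl (x.re * y.im) + R.fl (x.im * y.re)) - (x.re * y.im + x.im * y.re)) ^ 2 := by
    rw [Complex.sq_norm, Complex.normSq_apply]
    simp only [mul, Complex.sub_re, Complex.sub_im, Complex.mul_re, Complex.mul_im]
    ring
  rw [h3, h4]
  linarith

theorem norm_stored_mul_sub_le (hμ : 0 ≤ μ) {w w' : ℂ} (hw : ‖w' - w‖ ≤ μ * ‖w‖) (y : ℂ) :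
    ‖R.mul w' y - w * y‖ ≤ storedMulErr μ * (‖w‖ * ‖y‖) := by
  have h1 := R.norm_mul_sub_le hμ w' y
  have h2 : ‖w'‖ ≤ (1 + μ) * ‖w‖ := by
    have := norm_add_le w (w' - w)
    rw [add_sub_cancel] at this
    linarith
  have h3 : R.mul w' y - w * y = (R.mul w' y - w' * y) + (w' - w) * y := by ring
  rw [h3]
  refine (norm_add_le _ _).trans ?_
  rw [norm_mul]
  have h4 := mul_le_mul_of_nonneg_right hw (norm_nonneg y)
  have h5 : mulErr μ * (‖w'‖ * ‖y‖) ≤ mulErr μ * (((1 + μ) * ‖w‖) * ‖y‖) :=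
    mul_le_mul_of_nonneg_left (mul_le_mul_of_nonneg_right h2 (norm_nonneg y)) (mulErr_nonneg hμ)
  unfold storedMulErr
  linarith

end Rounding

/-! ## The Euclidean norm of a complex vector -/

/-- The Euclidean norm. -/
def twoNorm {ι : Type*} [Fintype ι] (x : ι → ℂ) : ℝ := √(∑ i, ‖x i‖ ^ 2)

section TwoNorm

variable {ι : Type*} [Fintype ι]

theorem twoNorm_eq_norm (x : ι → ℂ) : twoNorm x = ‖WithLp.toLp 2 x‖ := by
  rw [EuclideanSpace.norm_eq]; rfl

theorem twoNorm_nonneg (x : ι → ℂ) : 0 ≤ twoNorm x := Real.sqrt_nonneg _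

theorem twoNorm_sq (x : ι → ℂ) : twoNorm x ^ 2 = ∑ i, ‖x i‖ ^ 2 :=
  Real.sq_sqrt (Finset.sum_nonneg fun _ _ => sq_nonneg _)

theorem twoNorm_add_le (x y : ι → ℂ) : twoNorm (x + y) ≤ twoNorm x + twoNorm y := by
  simp only [twoNorm_eq_norm, WithLp.toLp_add]
  exact norm_add_le _ _

theorem twoNorm_mono {x y : ι → ℂ} (h : ∀ i, ‖x i‖ ≤ ‖y i‖) : twoNorm x ≤ twoNorm y :=
  Real.sqrt_le_sqrt (Finset.sum_le_sum fun i _ => pow_le_pow_left₀ (norm_nonneg _) (h i) 2)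

theorem twoNorm_ofReal_smul_norm {a : ℝ} (ha : 0 ≤ a) (x : ι → ℂ) :
    twoNorm (fun i => ((a * ‖x i‖ : ℝ) : ℂ)) = a * twoNorm x := by
  refine (sq_eq_sq₀ (twoNorm_nonneg _) (mul_nonneg ha (twoNorm_nonneg _))).mp ?_
  rw [mul_pow, twoNorm_sq, twoNorm_sq, Finset.mul_sum]
  refine Finset.sum_congr rfl fun i _ => ?_
  rw [Complex.norm_real, Real.norm_eq_abs, sq_abs, mul_pow]

theorem twoNorm_le_of_norm_le_add {x y z : ι → ℂ} {a b : ℝ} (ha : 0 ≤ a) (hb : 0 ≤ b)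
    (h : ∀ i, ‖x i‖ ≤ a * ‖y i‖ + b * ‖z i‖) : twoNorm x ≤ a * twoNorm y + b * twoNorm z := by
  rw [← twoNorm_ofReal_smul_norm ha, ← twoNorm_ofReal_smul_norm hb]
  refine le_trans (twoNorm_mono fun i => ?_) (twoNorm_add_le _ _)
  rw [Pi.add_apply, ← Complex.ofReal_add, Complex.norm_real, Real.norm_eq_abs]
  exact (h i).trans (le_abs_self _)

theorem norm_apply_le_twoNorm (x : ι → ℂ) (i : ι) : ‖x i‖ ≤ twoNorm x := by
  refine Real.le_sqrt_of_sq_le ?_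
  exact Finset.single_le_sum (f := fun i => ‖x i‖ ^ 2) (fun _ _ => sq_nonneg _)
    (Finset.mem_univ i)

theorem twoNorm_le_sqrt_card_mul {x : ι → ℂ} {b : ℝ} (hb : 0 ≤ b) (h : ∀ i, ‖x i‖ ≤ b) :
    twoNorm x ≤ √(Fintype.card ι) * b := by
  refine le_of_sq_le_sq ?_ (by positivity)
  rw [twoNorm_sq, mul_pow, Real.sq_sqrt (by positivity)]
  calc ∑ i, ‖x i‖ ^ 2 ≤ ∑ _i : ι, b ^ 2 :=
        Finset.sum_le_sum fun i _ => pow_le_pow_left₀ (norm_nonneg _) (h i) 2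
    _ = _ := by simp

end TwoNorm

/-! ## The radix-2 fast Fourier transform -/

/-- Position of the `i`-th entry of even index. -/
def evenIdx {q : ℕ} (i : Fin (2 ^ q)) : Fin (2 ^ (q + 1)) :=
  ⟨2 * i.1, by have := i.2; omega⟩

/-- Position of the `i`-th entry of odd index. -/
def oddIdx {q : ℕ} (i : Fin (2 ^ q)) : Fin (2 ^ (q + 1)) :=
  ⟨2 * i.1 + 1, by have := i.2; omega⟩

/-- Position of the `i`-th entry of the first half. -/
def lowIdx {q : ℕ} (i : Fin (2 ^ q)) : Fin (2 ^ (q + 1)) :=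
  ⟨i.1, by have := i.2; omega⟩

/-- Position of the `i`-th entry of the second half. -/
def highIdx {q : ℕ} (i : Fin (2 ^ q)) : Fin (2 ^ (q + 1)) :=
  ⟨i.1 + 2 ^ q, by have := i.2; omega⟩

theorem bijective_evenIdx_oddIdx (q : ℕ) :
    Function.Bijective (Sum.elim (evenIdx (q := q)) oddIdx) := by
  rw [Fintype.bijective_iff_injective_and_card]
  constructor
  · rintro (i | i) (j | j) h <;> simp [evenIdx, oddIdx] at h ⊢ <;> omega
  · simp [pow_succ]; ring

theorem bijective_lowIdx_highIdx (q : ℕ) :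
    Function.Bijective (Sum.elim (lowIdx (q := q)) highIdx) := by
  rw [Fintype.bijective_iff_injective_and_card]
  constructor
  · rintro (i | i) (j | j) h <;> have := i.2 <;> have := j.2 <;>
      simp [lowIdx, highIdx] at h ⊢ <;> omega
  · simp [pow_succ]; ring

theorem sum_evenIdx_add_sum_oddIdx {q : ℕ} {M : Type*} [AddCommMonoid M]
    (f : Fin (2 ^ (q + 1)) → M) : ∑ i, f i = ∑ i, f (evenIdx i) + ∑ i, f (oddIdx i) := by
  rw [← (bijective_evenIdx_oddIdx q).sum_comp, Fintype.sum_sum_type]; rfl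

theorem sum_lowIdx_add_sum_highIdx {q : ℕ} {M : Type*} [AddCommMonoid M]
    (f : Fin (2 ^ (q + 1)) → M) : ∑ i, f i = ∑ i, f (lowIdx i) + ∑ i, f (highIdx i) := by
  rw [← (bijective_lowIdx_highIdx q).sum_comp, Fintype.sum_sum_type]; rfl

theorem forall_lowIdx_highIdx {q : ℕ} {p : Fin (2 ^ (q + 1)) → Prop}
    (hl : ∀ i, p (lowIdx i)) (hh : ∀ i, p (highIdx i)) : ∀ k, p k := by
  intro k
  obtain ⟨i | i, rfl⟩ := (bijective_lowIdx_highIdx q).2 k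
  exacts [hl i, hh i]

namespace Rounding

variable {μ : ℝ} (R : Rounding μ)

theorem fft_lowIdx (w : ℕ → ℕ → ℂ) (q : ℕ) (x : Fin (2 ^ (q + 1)) → ℂ) (j : Fin (2 ^ q)) :
    R.fft w (q + 1) x (lowIdx j) = R.add (R.fft w q (x ∘ evenIdx) j)
      (R.mul (w q j.1) (R.fft w q (x ∘ oddIdx) j)) := by
  rw [fft]
  exact dif_pos j.2

theorem fft_highIdx (w : ℕ → ℕ → ℂ) (q : ℕ) (x : Fin (2 ^ (q + 1)) → ℂ) (j : Fin (2 ^ q)) :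
    R.fft w (q + 1) x (highIdx j) = R.sub (R.fft w q (x ∘ evenIdx) j)
      (R.mul (w q j.1) (R.fft w q (x ∘ oddIdx) j)) := by
  rw [fft]
  have h : ¬ (highIdx j).1 < 2 ^ q := by simp [highIdx]
  have hj : (highIdx j).1 - 2 ^ q = j.1 := by simp [highIdx]
  dsimp only
  rw [dif_neg h]
  simp only [hj]
  rfl

end Rounding

/-- `ρ p` is a primitive root of unity of order `2 ^ p`, and the square of `ρ (p + 1)`. -/
structure IsRootTower (ρ : ℕ → ℂ) : Prop where
  one : ρ 1 = -1
  sq : ∀ p, ρ (p + 1) ^ 2 = ρ p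

/-- The discrete Fourier transform of length `2 ^ q`. -/
def dft (ρ : ℕ → ℂ) (q : ℕ) (x : Fin (2 ^ q) → ℂ) (k : Fin (2 ^ q)) : ℂ :=
  ∑ h, ρ q ^ (k.1 * h.1) * x h

/-- The step that combines two transforms of length `2 ^ q` into one of length `2 ^ (q + 1)`. -/
def butterfly (ρ : ℕ → ℂ) (q : ℕ) (e o : Fin (2 ^ q) → ℂ) (k : Fin (2 ^ (q + 1))) : ℂ :=
  if h : k.1 < 2 ^ q then e ⟨k.1, h⟩ + ρ (q + 1) ^ k.1 * o ⟨k.1, h⟩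
  else
    have h' : k.1 - 2 ^ q < 2 ^ q := by have := k.2; omega
    e ⟨k.1 - 2 ^ q, h'⟩ - ρ (q + 1) ^ (k.1 - 2 ^ q) * o ⟨k.1 - 2 ^ q, h'⟩

section Dft

variable {ρ : ℕ → ℂ} {q : ℕ}

theorem butterfly_lowIdx (e o : Fin (2 ^ q) → ℂ) (j : Fin (2 ^ q)) :
    butterfly ρ q e o (lowIdx j) = e j + ρ (q + 1) ^ j.1 * o j :=
  dif_pos j.2

theorem butterfly_highIdx (e o : Fin (2 ^ q) → ℂ) (j : Fin (2 ^ q)) :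
    butterfly ρ q e o (highIdx j) = e j - ρ (q + 1) ^ j.1 * o j := by
  have h : ¬ (highIdx j).1 < 2 ^ q := by simp [highIdx]
  have hj : (highIdx j).1 - 2 ^ q = j.1 := by simp [highIdx]
  rw [butterfly, dif_neg h]
  simp only [hj]

theorem IsRootTower.pow_two_pow (hρ : IsRootTower ρ) (p : ℕ) : ρ (p + 1) ^ 2 ^ p = -1 := by
  induction p with
  | zero => simpa using hρ.one
  | succ p ih => rw [pow_succ', pow_mul, hρ.sq, ih]

theorem IsRootTower.norm_eq_one (hρ : IsRootTower ρ) (p : ℕ) : ‖ρ p‖ = 1 := by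
  induction p with
  | zero => rw [← hρ.sq, hρ.one]; simp
  | succ p ih =>
    have h := congrArg norm (hρ.sq p)
    rw [norm_pow, ih] at h
    exact (pow_eq_one_iff_of_nonneg (norm_nonneg _) two_ne_zero).mp h

theorem dft_succ (hρ : IsRootTower ρ) (x : Fin (2 ^ (q + 1)) → ℂ) :
    dft ρ (q + 1) x = butterfly ρ q (dft ρ q (x ∘ evenIdx)) (dft ρ q (x ∘ oddIdx)) := by
  funext k
  revert k
  have h2 : ∀ j i : ℕ, ρ (q + 1) ^ (j * (2 * i)) = ρ q ^ (j * i) := fun j i => by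
    rw [← hρ.sq q, ← pow_mul]; congr 1; ring
  have h3 : ∀ j i : ℕ, ρ (q + 1) ^ (j * (2 * i + 1)) = ρ (q + 1) ^ j * ρ q ^ (j * i) :=
    fun j i => by rw [← h2, ← pow_add]; congr 1; ring
  -- Periodicity of the half-length transforms: the second half of the output reuses their values,
  -- and only the twiddle factor changes sign.
  have h4 : ∀ i : ℕ, ρ q ^ (2 ^ q * i) = 1 := fun i => by
    rw [← h2, show 2 ^ q * (2 * i) = 2 ^ q * 2 * i by ring, pow_mul, pow_mul, hρ.pow_two_pow]
    simp
  refine forall_lowIdx_highIdx (fun j => ?_) (fun j => ?_)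
  · rw [butterfly_lowIdx]
    simp only [dft, sum_evenIdx_add_sum_oddIdx, Finset.mul_sum]
    simp only [lowIdx, evenIdx, oddIdx, Function.comp_apply, h2, h3, mul_assoc]
  · rw [butterfly_highIdx, sub_eq_add_neg]
    simp only [dft, sum_evenIdx_add_sum_oddIdx, Finset.mul_sum, ← Finset.sum_neg_distrib]
    simp only [highIdx, evenIdx, oddIdx, Function.comp_apply, h2, h3, add_mul, pow_add, h4,
      hρ.pow_two_pow, mul_one, mul_neg, neg_mul, mul_assoc]

theorem dft_sub (x y : Fin (2 ^ q) → ℂ) : dft ρ q (x - y) = dft ρ q x - dft ρ q y := by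
  funext k
  simp only [dft, Pi.sub_apply, mul_sub, Finset.sum_sub_distrib]

theorem butterfly_sub (e o e' o' : Fin (2 ^ q) → ℂ) :
    butterfly ρ q e o - butterfly ρ q e' o' = butterfly ρ q (e - e') (o - o') := by
  funext k
  revert k
  refine forall_lowIdx_highIdx (fun j => ?_) (fun j => ?_)
  · simp only [Pi.sub_apply, butterfly_lowIdx]; ring
  · simp only [Pi.sub_apply, butterfly_highIdx]; ring

/-- The parallelogram law applied to each pair of outputs. This is the reason for using the
Euclidean norm: a butterfly scales errors and data by the same `√2`. -/
theorem twoNorm_butterfly_sq (hρ : IsRootTower ρ) (e o : Fin (2 ^ q) → ℂ) :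
    twoNorm (butterfly ρ q e o) ^ 2 = 2 * (twoNorm e ^ 2 + twoNorm o ^ 2) := by
  simp only [twoNorm_sq, sum_lowIdx_add_sum_highIdx, butterfly_lowIdx, butterfly_highIdx]
  rw [← Finset.sum_add_distrib, ← Finset.sum_add_distrib, Finset.mul_sum]
  refine Finset.sum_congr rfl fun j _ => ?_
  have h := parallelogram_law_with_norm ℝ (e j) (ρ (q + 1) ^ j.1 * o j)
  rw [norm_mul, norm_pow, hρ.norm_eq_one, one_pow, one_mul] at h
  simpa only [sq] using h

theorem twoNorm_evenIdx_sq_add_oddIdx_sq (x : Fin (2 ^ (q + 1)) → ℂ) :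
    twoNorm (x ∘ evenIdx) ^ 2 + twoNorm (x ∘ oddIdx) ^ 2 = twoNorm x ^ 2 := by
  simp only [twoNorm_sq, sum_evenIdx_add_sum_oddIdx (fun i => ‖x i‖ ^ 2), Function.comp_apply]

theorem dft_zero (x : Fin (2 ^ 0) → ℂ) : dft ρ 0 x = x := by
  funext i
  have hi : ∀ i : Fin (2 ^ 0), i = ⟨0, by simp⟩ := fun i => Fin.ext (by have := i.2; omega)
  rw [dft, Finset.sum_eq_single i]
  · have h0 : i.1 = 0 := congrArg Fin.val (hi i)
    rw [h0, zero_mul, pow_zero, one_mul]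
  · intro b _ hb; exact absurd ((hi b).trans (hi i).symm) hb
  · exact fun h => absurd (Finset.mem_univ i) h

/-- Parseval's identity. -/
theorem twoNorm_dft (hρ : IsRootTower ρ) (x : Fin (2 ^ q) → ℂ) :
    twoNorm (dft ρ q x) = √(2 ^ q) * twoNorm x := by
  refine (sq_eq_sq₀ (twoNorm_nonneg _) (mul_nonneg (Real.sqrt_nonneg _) (twoNorm_nonneg _))).mp ?_
  rw [mul_pow, Real.sq_sqrt (by positivity)]
  induction q with
  | zero =>
    rw [dft_zero, pow_zero (2 : ℝ), one_mul]
  | succ q ih =>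
    rw [dft_succ hρ, twoNorm_butterfly_sq hρ, ih, ih, ← twoNorm_evenIdx_sq_add_oddIdx_sq x]
    ring

end Dft

namespace Rounding

variable {μ : ℝ} (R : Rounding μ) {ρ : ℕ → ℂ} {w : ℕ → ℕ → ℂ}

/-- Local error of one level, measured against the exact butterfly of the computed half transforms,
so that it can be chained by induction. -/
theorem twoNorm_fft_succ_sub_butterfly_le (hμ : 0 ≤ μ) (hρ : IsRootTower ρ) {q : ℕ}
    (hw : ∀ j < 2 ^ q, ‖w q j - ρ (q + 1) ^ j‖ ≤ μ) (x : Fin (2 ^ (q + 1)) → ℂ) :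
    twoNorm (R.fft w (q + 1) x -
        butterfly ρ q (R.fft w q (x ∘ evenIdx)) (R.fft w q (x ∘ oddIdx))) ≤
      butterflyErr μ *
        twoNorm (butterfly ρ q (R.fft w q (x ∘ evenIdx)) (R.fft w q (x ∘ oddIdx))) := by
  set e := R.fft w q (x ∘ evenIdx)
  set o := R.fft w q (x ∘ oddIdx)
  have hβ := storedMulErr_nonneg hμ
  have hmul : ∀ j : Fin (2 ^ q),
      ‖R.mul (w q j.1) (o j) - ρ (q + 1) ^ j.1 * o j‖ ≤ storedMulErr μ * ‖o j‖ := by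
    intro j
    -- The exact roots have modulus one, so their absolute error `μ` is also a relative error.
    have h1 : ‖ρ (q + 1) ^ j.1‖ = 1 := by rw [norm_pow, hρ.norm_eq_one, one_pow]
    have h2 := R.norm_stored_mul_sub_le hμ (w := ρ (q + 1) ^ j.1) (w' := w q j.1)
      (by rw [h1, mul_one]; exact hw j.1 j.2) (o j)
    rwa [h1, one_mul] at h2
  -- `o` repeated in both halves: it carries the multiplication errors, which occur once in each
  -- half. Its squared norm `2‖o‖²` is at most that of the butterfly, which makes these errors
  -- relative to the output.
  let oo : Fin (2 ^ (q + 1)) → ℂ := butterfly (fun _ => 0) q o 0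
  have hlow : ∀ j, oo (lowIdx j) = o j := fun j => by
    simp only [oo, butterfly_lowIdx, Pi.zero_apply, mul_zero, add_zero]
  have hhigh : ∀ j, oo (highIdx j) = o j := fun j => by
    simp only [oo, butterfly_highIdx, Pi.zero_apply, mul_zero, sub_zero]
  have hoo : twoNorm oo ≤ twoNorm (butterfly ρ q e o) := by
    refine le_of_sq_le_sq ?_ (twoNorm_nonneg _)
    rw [twoNorm_butterfly_sq hρ, twoNorm_sq oo, sum_lowIdx_add_sum_highIdx]
    simp only [hlow, hhigh, ← twoNorm_sq]
    nlinarith [sq_nonneg (twoNorm e)]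
  have key : ∀ k, ‖(R.fft w (q + 1) x - butterfly ρ q e o) k‖ ≤
      μ * ‖butterfly ρ q e o k‖ + ((1 + μ) * storedMulErr μ) * ‖oo k‖ := by
    have aux : ∀ a b p c : ℂ, ‖a - (b + p)‖ ≤ μ * ‖b + p‖ → ‖p‖ ≤ storedMulErr μ * ‖c‖ →
        ‖a - b‖ ≤ μ * ‖b‖ + ((1 + μ) * storedMulErr μ) * ‖c‖ := by
      intro a b p c h1 h2
      have h3 : a - b = (a - (b + p)) + p := by ring
      rw [h3]
      have h4 := norm_add_le (a - (b + p)) p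
      have h5 := mul_le_mul_of_nonneg_left (norm_add_le b p) hμ
      have h6 := mul_le_mul_of_nonneg_left h2 hμ
      linarith
    refine forall_lowIdx_highIdx (fun j => ?_) (fun j => ?_)
    · rw [Pi.sub_apply, hlow, butterfly_lowIdx, R.fft_lowIdx]
      refine aux _ _ (R.mul (w q j.1) (o j) - ρ (q + 1) ^ j.1 * o j) _ ?_ (hmul j)
      have h := R.norm_add_sub_le hμ (e j) (R.mul (w q j.1) (o j))
      have hs : e j + ρ (q + 1) ^ j.1 * o j +
          (R.mul (w q j.1) (o j) - ρ (q + 1) ^ j.1 * o j) = e j + R.mul (w q j.1) (o j) := by ring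
      rwa [hs]
    · rw [Pi.sub_apply, hhigh, butterfly_highIdx, R.fft_highIdx]
      refine aux _ _ (-(R.mul (w q j.1) (o j) - ρ (q + 1) ^ j.1 * o j)) _ ?_
        (by rw [norm_neg]; exact hmul j)
      have h := R.norm_sub_sub_le hμ (e j) (R.mul (w q j.1) (o j))
      have hs : e j - ρ (q + 1) ^ j.1 * o j +
          -(R.mul (w q j.1) (o j) - ρ (q + 1) ^ j.1 * o j) = e j - R.mul (w q j.1) (o j) := by ring
      rwa [hs]
  have h1 := twoNorm_le_of_norm_le_add hμ (by positivity) key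
  have h2 := mul_le_mul_of_nonneg_left hoo (by positivity : 0 ≤ (1 + μ) * storedMulErr μ)
  unfold butterflyErr
  linarith

/-- Error of the FFT in the Euclidean norm. -/
theorem twoNorm_fft_sub_dft_le (hμ : 0 ≤ μ) (hρ : IsRootTower ρ) {q : ℕ}
    (hw : ∀ p < q, ∀ j < 2 ^ p, ‖w p j - ρ (p + 1) ^ j‖ ≤ μ) (x : Fin (2 ^ q) → ℂ) :
    twoNorm (R.fft w q x - dft ρ q x) ≤
      ((1 + butterflyErr μ) ^ q - 1) * (√(2 ^ q) * twoNorm x) := by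
  have hη := butterflyErr_nonneg hμ
  induction q with
  | zero =>
    rw [dft_zero]
    simp [fft, twoNorm]
  | succ q ih =>
    have hw' : ∀ p < q, ∀ j < 2 ^ p, ‖w p j - ρ (p + 1) ^ j‖ ≤ μ :=
      fun p hp => hw p (hp.trans q.lt_succ_self)
    have h1 := R.twoNorm_fft_succ_sub_butterfly_le hμ hρ (hw q q.lt_succ_self) x
    set e := R.fft w q (x ∘ evenIdx)
    set o := R.fft w q (x ∘ oddIdx)
    set κ := (1 + butterflyErr μ) ^ q - 1
    have hκ : 0 ≤ κ := sub_nonneg.mpr (one_le_pow₀ (by linarith))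
    -- Inherited error: by linearity this is the butterfly of the errors of the two halves, to which
    -- the induction hypothesis applies.
    have h2 : twoNorm (butterfly ρ q e o - dft ρ (q + 1) x) ≤
        κ * (√(2 ^ (q + 1)) * twoNorm x) := by
      have hx := twoNorm_nonneg x
      refine le_of_sq_le_sq ?_ (by positivity)
      rw [dft_succ hρ, butterfly_sub, twoNorm_butterfly_sq hρ]
      have he := pow_le_pow_left₀ (twoNorm_nonneg _) (ih hw' (x ∘ evenIdx)) 2
      have ho := pow_le_pow_left₀ (twoNorm_nonneg _) (ih hw' (x ∘ oddIdx)) 2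
      rw [mul_pow, mul_pow, Real.sq_sqrt (by positivity)] at he ho
      rw [mul_pow, mul_pow, Real.sq_sqrt (by positivity), ← twoNorm_evenIdx_sq_add_oddIdx_sq,
        pow_succ (2 : ℝ) q]
      linarith
    have h3 : twoNorm (butterfly ρ q e o) ≤ (1 + κ) * (√(2 ^ (q + 1)) * twoNorm x) := by
      have h := twoNorm_add_le (dft ρ (q + 1) x) (butterfly ρ q e o - dft ρ (q + 1) x)
      rw [add_sub_cancel, twoNorm_dft hρ] at h
      linarith
    have h4 := twoNorm_add_le (R.fft w (q + 1) x - butterfly ρ q e o)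
      (butterfly ρ q e o - dft ρ (q + 1) x)
    rw [sub_add_sub_cancel] at h4
    have h5 := mul_le_mul_of_nonneg_left h3 hη
    have h6 : (1 + butterflyErr μ) ^ (q + 1) - 1 = butterflyErr μ * (1 + κ) + κ := by
      simp only [κ]; ring
    rw [h6]
    linarith

end Rounding

/-! ## First order expansion of the error bound -/

/-- Taylor's formula on `[0, 1]`. The constant depends on `G` alone, which yields uniformity in the
rounding and in the stored values. -/
theorem exists_le_mul_add_sq {G : ℝ → ℝ} {a b : ℝ} (hG : ContDiff ℝ 2 G) (h0 : G 0 = 0)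
    (ha : HasDerivAt G a 0) (hab : a ≤ b) :
    ∃ C > 0, ∀ μ : ℝ, 0 < μ → μ ≤ 1 → G μ ≤ μ * b + C * μ ^ 2 := by
  obtain ⟨C, hC⟩ := exists_taylor_mean_remainder_bound (n := 1) (zero_le_one (α := ℝ))
    (f := G) (by exact_mod_cast hG.contDiffOn)
  refine ⟨max C 1, lt_max_of_lt_right one_pos, fun μ hμ hμ1 => ?_⟩
  have h := hC μ ⟨hμ.le, hμ1⟩
  have hd : derivWithin G (Set.Icc 0 1) 0 = a :=
    ha.hasDerivWithinAt.derivWithin (uniqueDiffOn_Icc one_pos 0 (by simp))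
  rw [taylorWithinEval_succ, taylor_within_zero_eval, iteratedDerivWithin_one, hd, h0] at h
  norm_num at h
  have h1 := (abs_le.mp h).2
  have h2 := mul_le_mul_of_nonneg_right (le_max_left C 1) (sq_nonneg μ)
  have h3 := mul_le_mul_of_nonneg_left hab hμ.le
  linarith

/-- Relative error of the FFT of length `2 ^ q` in the Euclidean norm. -/
def fftErr (q : ℕ) (μ : ℝ) : ℝ := (1 + butterflyErr μ) ^ q - 1

/-- Error of the computed diagonal blocks, if `K` bounds the norms of these blocks. -/
def specErr (q : ℕ) (K μ : ℝ) : ℝ := K * ((1 + butterflyErr μ) ^ q * (1 + μ) ^ 2 - 1)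

/-- Error of the computed exponentials of the diagonal blocks. -/
def expErr (q : ℕ) (K τ μ : ℝ) : ℝ :=
  specErr q K μ * Real.exp (specErr q K μ) +
    μ * τ * (1 + specErr q K μ * Real.exp (specErr q K μ))

/-- Error of the computed inverse transform of the exponentials. -/
def invErr (q m : ℕ) (K τ L μ : ℝ) : ℝ :=
  m * (fftErr q μ * (√(2 ^ q) * L + expErr q K τ μ)) + expErr q K τ μ

/-- Error of the output, where `δ * μ` bounds the relative error of the division by `2 ^ q`. -/
def outErr (q m : ℕ) (K τ L δ μ : ℝ) : ℝ :=
  storedMulErr μ * L +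
    (1 + storedMulErr μ) * (invErr q m K τ L μ + δ * μ * (L + invErr q m K τ L μ))

section Expansion

theorem storedMulErr_zero : storedMulErr 0 = 0 := by simp [storedMulErr, mulErr]

theorem butterflyErr_zero : butterflyErr 0 = 0 := by simp [butterflyErr, storedMulErr_zero]

theorem fftErr_zero (q : ℕ) : fftErr q 0 = 0 := by simp [fftErr, butterflyErr_zero]

theorem specErr_zero (q : ℕ) (K : ℝ) : specErr q K 0 = 0 := by simp [specErr, butterflyErr_zero]

theorem expErr_zero (q : ℕ) (K τ : ℝ) : expErr q K τ 0 = 0 := by simp [expErr, specErr_zero]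

theorem invErr_zero (q m : ℕ) (K τ L : ℝ) : invErr q m K τ L 0 = 0 := by
  simp [invErr, expErr_zero, fftErr_zero]

theorem outErr_zero (q m : ℕ) (K τ L δ : ℝ) : outErr q m K τ L δ 0 = 0 := by
  simp [outErr, invErr_zero, storedMulErr_zero]

theorem hasDerivAt_storedMulErr : HasDerivAt storedMulErr (2 * √2 + 1) 0 := by
  have h1 : HasDerivAt mulErr (√2 * (2 * 1 + 2 * 0)) 0 := by
    have := ((hasDerivAt_id (0 : ℝ)).const_mul 2).add ((hasDerivAt_id (0 : ℝ)).pow 2)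
    convert! this.const_mul √2 using 1
    simp
  convert! (h1.mul ((hasDerivAt_id (0 : ℝ)).const_add 1)).add (hasDerivAt_id (0 : ℝ)) using 1
  simp [mulErr]; ring

theorem hasDerivAt_butterflyErr : HasDerivAt butterflyErr (2 * √2 + 2) 0 := by
  convert! (hasDerivAt_id (0 : ℝ)).add
    (((hasDerivAt_id (0 : ℝ)).const_add 1).mul hasDerivAt_storedMulErr) using 1
  simp [storedMulErr_zero]; ring

theorem hasDerivAt_fftErr (q : ℕ) : HasDerivAt (fftErr q) (q * (2 * √2 + 2)) 0 := by
  convert! ((hasDerivAt_butterflyErr.const_add 1).pow q).sub_const 1 using 1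
  simp [butterflyErr_zero]

theorem hasDerivAt_specErr (q : ℕ) (K : ℝ) :
    HasDerivAt (specErr q K) (K * (q * (2 * √2 + 2) + 2)) 0 := by
  convert! ((((hasDerivAt_butterflyErr.const_add 1).pow q).mul
    (((hasDerivAt_id (0 : ℝ)).const_add 1).pow 2)).sub_const 1).const_mul K using 1
  simp [butterflyErr_zero]

theorem hasDerivAt_expErr (q : ℕ) (K τ : ℝ) :
    HasDerivAt (expErr q K τ) (K * (q * (2 * √2 + 2) + 2) + τ) 0 := by
  have h := hasDerivAt_specErr q K
  have h1 := h.mul h.exp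
  convert! h1.add (((hasDerivAt_id (0 : ℝ)).mul_const τ).mul (h1.const_add 1)) using 1
  simp [specErr_zero]

theorem hasDerivAt_invErr (q m : ℕ) (K τ L : ℝ) :
    HasDerivAt (invErr q m K τ L) (m * (q * (2 * √2 + 2) * (√(2 ^ q) * L)) +
      (K * (q * (2 * √2 + 2) + 2) + τ)) 0 := by
  have h := hasDerivAt_expErr q K τ
  convert! (((hasDerivAt_fftErr q).mul (h.const_add (√(2 ^ q) * L))).const_mul (m : ℝ)).add h
    using 1
  simp [expErr_zero, fftErr_zero]

theorem hasDerivAt_outErr (q m : ℕ) (K τ L δ : ℝ) :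
    HasDerivAt (outErr q m K τ L δ) ((2 * √2 + 1) * L + (m * (q * (2 * √2 + 2) * (√(2 ^ q) * L)) +
      (K * (q * (2 * √2 + 2) + 2) + τ) + δ * L)) 0 := by
  have h := hasDerivAt_invErr q m K τ L
  have hs := hasDerivAt_storedMulErr
  convert! (hs.mul_const L).add ((hs.const_add 1).mul
    (h.add (((hasDerivAt_id (0 : ℝ)).const_mul δ).mul (h.const_add L)))) using 1
  simp [storedMulErr_zero, invErr_zero]

theorem contDiff_outErr (q m : ℕ) (K τ L δ : ℝ) : ContDiff ℝ 2 (outErr q m K τ L δ) := by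
  unfold outErr invErr expErr specErr fftErr butterflyErr storedMulErr mulErr
  fun_prop

/-- The first order term of the error bound, compared with `phi`. -/
theorem deriv_outErr_le {q m : ℕ} (hm : m ≠ 0) {M τ L : ℝ} (hM : 0 ≤ M) (hτ : 0 ≤ τ)
    (hL : 0 ≤ L) :
    (2 * √2 + 1) * L + (m * (q * (2 * √2 + 2) * (√(2 ^ q) * L)) +
      (m * 2 ^ q * M * (q * (2 * √2 + 2) + 2) + τ) + (if q = 0 then 0 else 1) * L) ≤
      m * phi m (2 ^ q) M L τ := by
  have hlog : Real.logb 2 ((2 ^ q : ℕ) : ℝ) = q := by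
    push_cast
    rw [Real.logb_pow, Real.logb_self_eq_one (by norm_num), mul_one]
  have h2 : 1 ≤ √2 := Real.one_le_sqrt.mpr (by norm_num)
  have hm1 : (1 : ℝ) ≤ m := by exact_mod_cast Nat.one_le_iff_ne_zero.mpr hm
  have hq0 : (0 : ℝ) ≤ q := q.cast_nonneg
  have hs : 0 ≤ √(2 ^ q : ℝ) := Real.sqrt_nonneg _
  unfold phi
  rw [hlog]
  push_cast
  unfold zetaConst gammaConst
  set s := √2
  -- The division by `n` is absorbed by the slack `2√2 - 1` between `γ = 4√2 + 1` and the actual FFT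
  -- slope `2√2 + 2`. For `q = 0` there is no slack, so the division must then be error-free.
  have hδ : (if q = 0 then 0 else 1 : ℝ) ≤ m * (q * (2 * s - 1) * √(2 ^ q)) := by
    split_ifs with hq
    · have : 0 ≤ 2 * s - 1 := by linarith
      positivity
    · have hq1 : (1 : ℝ) ≤ q := by exact_mod_cast Nat.one_le_iff_ne_zero.mpr hq
      have hsq : 1 ≤ √(2 ^ q : ℝ) := Real.one_le_sqrt.mpr (one_le_pow₀ (by norm_num))
      have h1 : (1 : ℝ) ≤ 2 * s - 1 := by linarith
      exact one_le_mul_of_one_le_of_one_le hm1 (one_le_mul_of_one_le_of_one_le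
        (one_le_mul_of_one_le_of_one_le hq1 h1) hsq)
  have e1 := mul_le_mul_of_nonneg_right hδ hL
  have e2 := mul_le_mul_of_nonneg_right hm1 (by positivity : 0 ≤ (2 * s + 1) * L)
  have e3 := mul_le_mul_of_nonneg_right hm1 hτ
  have hP : 0 ≤ m * 2 ^ q * M := by positivity
  have e4 : m * 2 ^ q * M * (q * (2 * s + 2) + 2) ≤
      m * (m * 2 ^ q * ((1 + 2 * s) + (4 * s + 1) * q) * M) := by
    have h1 : q * (2 * s + 2) + 2 ≤ (1 + 2 * s) + (4 * s + 1) * q := by nlinarith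
    have h2 := mul_le_mul_of_nonneg_left h1 hP
    have h3 := mul_le_mul_of_nonneg_right hm1
      (by positivity : 0 ≤ m * 2 ^ q * M * ((1 + 2 * s) + (4 * s + 1) * q))
    linarith
  nlinarith

end Expansion

/-! ## Roots of unity -/

/-- The primitive root of unity `exp (2πi / 2 ^ p)`. -/
def dyadicRoot (p : ℕ) : ℂ := Complex.exp (2 * Real.pi * Complex.I / (2 ^ p : ℂ))

theorem isPrimitiveRoot_dyadicRoot (p : ℕ) : IsPrimitiveRoot (dyadicRoot p) (2 ^ p) := by
  have := Complex.isPrimitiveRoot_exp (2 ^ p) (by positivity)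
  simpa [dyadicRoot] using this

theorem isRootTower_dyadicRoot : IsRootTower dyadicRoot where
  one := by
    rw [dyadicRoot, ← Complex.exp_pi_mul_I]
    congr 1
    ring
  sq p := by
    rw [dyadicRoot, dyadicRoot, ← Complex.exp_nat_mul]
    congr 1
    rw [pow_succ]
    push_cast
    field_simp

/-- Lets the same FFT analysis serve the transform with conjugate roots. -/
theorem isRootTower_inv {ρ : ℕ → ℂ} (hρ : IsRootTower ρ) : IsRootTower fun p => (ρ p)⁻¹ where
  one := by simp [hρ.one]
  sq p := by rw [inv_pow, hρ.sq]

theorem ApproxRoots.norm_sub_dyadicRoot_le {μ : ℝ} {q : ℕ} {w : ℕ → ℕ → ℂ}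
    (h : ApproxRoots μ q w) : ∀ p < q, ∀ j < 2 ^ p, ‖w p j - dyadicRoot (p + 1) ^ j‖ ≤ μ := by
  intro p hp j hj
  convert h p hp j hj using 3
  rw [dyadicRoot, ← Complex.exp_nat_mul]
  congr 1
  ring

theorem ApproxRoots.norm_conj_sub_dyadicRoot_inv_le {μ : ℝ} {q : ℕ} {w : ℕ → ℕ → ℂ}
    (h : ApproxRoots μ q w) :
    ∀ p < q, ∀ j < 2 ^ p, ‖conj (w p j) - (dyadicRoot (p + 1))⁻¹ ^ j‖ ≤ μ := by
  intro p hp j hj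
  rw [Complex.inv_eq_conj (isRootTower_dyadicRoot.norm_eq_one _), ← map_pow, ← map_sub,
    Complex.norm_conj]
  exact h.norm_sub_dyadicRoot_le p hp j hj

/-! ## Subgenerators -/

theorem norm_le_one_of_pow_norm_lt_one {θ : ℂ} {n : ℕ} (h : ‖θ ^ n‖ < 1) : ‖θ‖ ≤ 1 := by
  by_contra! h1
  rw [norm_pow] at h
  exact absurd (one_le_pow₀ h1.le) (not_le.mpr h)

theorem IsSubgenerator.sum_sum_le_zero {n m : ℕ} {U : Fin n → Matrix (Fin m) (Fin m) ℝ}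
    (hU : IsSubgenerator (blockToeplitz U)) (hn : 0 < n) (r : Fin m) :
    ∑ h, ∑ s, U h r s ≤ 0 := by
  have h := hU.2.2 (⟨0, hn⟩, r)
  rw [Fintype.sum_prod_type] at h
  convert h using 4 with k _ s _
  have hk : (⟨0, hn⟩ : Fin n) ≤ k := Nat.zero_le _
  have hk' : k - ⟨0, hn⟩ = k := by
    apply Fin.ext; rw [Fin.sub_val_of_le hk]; rfl
  simp only [blockToeplitz, Matrix.of_apply, if_pos hk, hk']

theorem IsSubgenerator.nonneg_of_ne {n m : ℕ} {U : Fin n → Matrix (Fin m) (Fin m) ℝ}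
    (hU : IsSubgenerator (blockToeplitz U)) (h : Fin n) (r s : Fin m) (hne : h.1 ≠ 0 ∨ r ≠ s) :
    0 ≤ U h r s := by
  have hn : 0 < n := by have := h.2; omega
  have hk : (⟨0, hn⟩ : Fin n) ≤ h := Nat.zero_le _
  have hk' : h - ⟨0, hn⟩ = h := by
    apply Fin.ext; rw [Fin.sub_val_of_le hk]; rfl
  have := hU.1 (⟨0, hn⟩, r) (h, s) (by
    intro he
    rw [Prod.mk.injEq] at he
    rcases hne with h1 | h1
    · exact h1 (by rw [← he.1])
    · exact h1 he.2)
  simpa only [blockToeplitz, Matrix.of_apply, if_pos hk, hk'] using this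

/-- The logarithmic norm of the diagonal blocks is nonpositive. -/
theorem IsSubgenerator.exists_normInf_circulantSpectrum_add_le {n m : ℕ}
    {U : Fin n → Matrix (Fin m) (Fin m) ℝ} (hU : IsSubgenerator (blockToeplitz U)) {ω θ : ℂ}
    (hω : ‖ω‖ = 1) (hθ : ‖θ‖ ≤ 1) (k : Fin n) :
    ∃ c : ℝ, normInf (circulantSpectrum ω θ (fun h => (U h).map Complex.ofReal) k +
      algebraMap ℂ _ (c : ℂ)) ≤ c := by
  have hn : 0 < n := by have := k.2; omega
  let z : Fin n := ⟨0, hn⟩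
  -- Any `c` dominating all `|U z r r|` works: it makes the diagonal of `U z + c` nonnegative.
  set c : ℝ := ∑ r, |U z r r|
  have hc0 : 0 ≤ c := Finset.sum_nonneg fun _ _ => abs_nonneg _
  have hcr : ∀ r, 0 ≤ U z r r + c := fun r => by
    have h1 : |U z r r| ≤ c := Finset.single_le_sum (f := fun r => |U z r r|) (fun _ _ => abs_nonneg _)
      (Finset.mem_univ r)
    have h2 := neg_abs_le (U z r r)
    linarith
  refine ⟨c, (normInf_le_iff hc0).mpr fun r => ?_⟩
  -- After the shift all coefficients are nonnegative and the factors `ω⁻¹ ^ _`, `θ ^ _` have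
  -- modulus at most one. Summing over `s` leaves `c` plus a row sum of the Toeplitz matrix, which
  -- is nonpositive.
  have hentry : ∀ s, ‖(circulantSpectrum ω θ (fun h => (U h).map Complex.ofReal) k +
      algebraMap ℂ _ (c : ℂ) : Matrix (Fin m) (Fin m) ℂ) r s‖ ≤
      ∑ h, U h r s + if r = s then c else 0 := by
    intro s
    have hterm : ∀ h : Fin n, ‖ω⁻¹ ^ (k.1 * h.1) * (θ ^ h.1 * (U h r s : ℂ)) +
        (if h = z then (if r = s then (c : ℂ) else 0) else 0)‖ ≤
        U h r s + (if h = z then (if r = s then c else 0) else 0) := by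
      intro h
      by_cases hz : h = z
      · subst hz
        by_cases hrs : r = s
        · subst hrs
          simp only [z, mul_zero, pow_zero, one_mul, if_true]
          rw [← Complex.ofReal_add, Complex.norm_real, Real.norm_eq_abs, abs_of_nonneg (hcr r)]
        · have := hU.nonneg_of_ne z r s (Or.inr hrs)
          simp only [z, mul_zero, pow_zero, one_mul, if_true, if_neg hrs, add_zero]
          rw [Complex.norm_real, Real.norm_eq_abs, abs_of_nonneg this]
      · have h0 : 0 ≤ U h r s := hU.nonneg_of_ne h r s (Or.inl fun h1 => hz (Fin.ext h1))
        rw [if_neg hz, if_neg hz, add_zero, add_zero, norm_mul, norm_mul, norm_pow, norm_pow,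
          norm_inv, hω, inv_one, one_pow, one_mul, Complex.norm_real, Real.norm_eq_abs,
          abs_of_nonneg h0]
        exact mul_le_of_le_one_left h0 (pow_le_one₀ (norm_nonneg _) hθ)
    have hsum : (circulantSpectrum ω θ (fun h => (U h).map Complex.ofReal) k +
        algebraMap ℂ _ (c : ℂ) : Matrix (Fin m) (Fin m) ℂ) r s =
        ∑ h : Fin n, (ω⁻¹ ^ (k.1 * h.1) * (θ ^ h.1 * (U h r s : ℂ)) +
          (if h = z then (if r = s then (c : ℂ) else 0) else 0)) := by
      rw [Finset.sum_add_distrib, Finset.sum_ite_eq' Finset.univ z, if_pos (Finset.mem_univ z),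
        Matrix.add_apply, Matrix.algebraMap_matrix_apply, circulantSpectrum, Matrix.sum_apply]
      rfl
    rw [hsum]
    refine (norm_sum_le _ _).trans ((Finset.sum_le_sum fun h _ => hterm h).trans (le_of_eq ?_))
    rw [Finset.sum_add_distrib, Finset.sum_ite_eq' Finset.univ z, if_pos (Finset.mem_univ z)]
  refine (Finset.sum_le_sum fun s _ => hentry s).trans ?_
  rw [Finset.sum_add_distrib, Finset.sum_ite_eq Finset.univ r, if_pos (Finset.mem_univ r),
    Finset.sum_comm]
  have := hU.sum_sum_le_zero hn r
  linarith

/-! ## Propagation of the errors through the algorithm -/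

theorem fftErr_nonneg (q : ℕ) {μ : ℝ} (hμ : 0 ≤ μ) : 0 ≤ fftErr q μ :=
  sub_nonneg.mpr (one_le_pow₀ (by linarith [butterflyErr_nonneg hμ]))

theorem specErr_nonneg (q : ℕ) {K μ : ℝ} (hK : 0 ≤ K) (hμ : 0 ≤ μ) : 0 ≤ specErr q K μ :=
  mul_nonneg hK (sub_nonneg.mpr (one_le_mul_of_one_le_of_one_le
    (one_le_pow₀ (by linarith [butterflyErr_nonneg hμ])) (one_le_pow₀ (by linarith))))

theorem expErr_nonneg (q : ℕ) {K τ μ : ℝ} (hK : 0 ≤ K) (hτ : 0 ≤ τ) (hμ : 0 ≤ μ) :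
    0 ≤ expErr q K τ μ := by
  have := specErr_nonneg q hK hμ
  unfold expErr
  positivity

namespace Rounding

variable {μ : ℝ} (R : Rounding μ) {q m : ℕ} {w : ℕ → ℕ → ℂ} {t : ℤ → ℂ}

theorem twoNorm_fft_sub_dft_perturbed_le (hμ : 0 ≤ μ) {ρ : ℕ → ℂ} (hρ : IsRootTower ρ)
    (hw : ∀ p < q, ∀ j < 2 ^ p, ‖w p j - ρ (p + 1) ^ j‖ ≤ μ) (x y : Fin (2 ^ q) → ℂ) :
    twoNorm (R.fft w q x - dft ρ q y) ≤
      fftErr q μ * (√(2 ^ q) * twoNorm x) + √(2 ^ q) * twoNorm (x - y) := by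
  have h1 := R.twoNorm_fft_sub_dft_le hμ hρ hw x
  have h2 := twoNorm_add_le (R.fft w q x - dft ρ q x) (dft ρ q (x - y))
  rw [twoNorm_dft hρ, dft_sub, sub_add_sub_cancel] at h2
  unfold fftErr
  linarith

theorem norm_stored_mul_ofReal_sub_le (hμ : 0 ≤ μ) {z z' : ℂ} (hz : ‖z' - z‖ ≤ μ * ‖z‖) (u : ℝ) :
    ‖R.mul z' u - z * u‖ ≤ ((1 + μ) ^ 2 - 1) * ‖z * u‖ := by
  have h1 := R.norm_mul_ofReal_sub_le hμ z' u
  have h2 : ‖z'‖ ≤ (1 + μ) * ‖z‖ := by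
    have := norm_add_le z (z' - z)
    rw [add_sub_cancel] at this
    linarith
  have h3 : R.mul z' u - z * u = (R.mul z' u - z' * u) + (z' - z) * u := by ring
  have h4 := norm_add_le (R.mul z' u - z' * u) ((z' - z) * u)
  rw [h3]
  rw [norm_mul] at h1 h4 ⊢
  have h5 := mul_le_mul_of_nonneg_right hz (norm_nonneg (u : ℂ))
  have h6 := mul_le_mul_of_nonneg_left (mul_le_mul_of_nonneg_right h2 (norm_nonneg (u : ℂ))) hμ
  linarith

/-- The scaled entries are at most `M`, so `√n` times their Euclidean norm is at most `n * M`;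
passing from entries to row sums costs `m`. Hence `K = m n M` in `specErr`. -/
theorem normInf_algV_sub_le (hμ : 0 ≤ μ) {θ : ℂ} (hθ : ‖θ‖ ≤ 1) (hw : ApproxRoots μ q w)
    (ht : ApproxPowers μ (2 ^ q) θ t) (U : Fin (2 ^ q) → Matrix (Fin m) (Fin m) ℝ) {M : ℝ}
    (hM : ∀ h r s, |U h r s| ≤ M) (hM0 : 0 ≤ M) (k : Fin (2 ^ q)) :
    normInf (R.algV w t (fun h => (U h).map Complex.ofReal) k -
      circulantSpectrum (dyadicRoot q) θ (fun h => (U h).map Complex.ofReal) k) ≤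
      specErr q (m * 2 ^ q * M) μ := by
  have ha : 0 ≤ (1 + μ) ^ 2 - 1 := by nlinarith
  have hb := fftErr_nonneg q hμ
  have hN : √(2 ^ q : ℝ) * √(2 ^ q : ℝ) = 2 ^ q := Real.mul_self_sqrt (by positivity)
  have hE : specErr q (m * 2 ^ q * M) μ =
      m * (fftErr q μ * (2 ^ q * ((1 + μ) ^ 2 * M)) + 2 ^ q * (((1 + μ) ^ 2 - 1) * M)) := by
    unfold specErr fftErr; ring
  rw [hE]
  refine normInf_le_of_entries_le (by positivity) fun r s => ?_
  set z : Fin (2 ^ q) → ℂ := fun h => θ ^ h.1 * (U h r s : ℂ) with hz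
  set z' : Fin (2 ^ q) → ℂ := fun h => R.mul (t (h.1 : ℤ)) (U h r s : ℂ)
  have hzM : ∀ h, ‖z h‖ ≤ M := fun h => by
    simp only [hz, norm_mul, norm_pow, Complex.norm_real, Real.norm_eq_abs]
    exact (mul_le_of_le_one_left (abs_nonneg _) (pow_le_one₀ (norm_nonneg _) hθ)).trans (hM h r s)
  have hzz : ∀ h, ‖(z' - z) h‖ ≤ ((1 + μ) ^ 2 - 1) * M := fun h => by
    have hp := ht (h.1 : ℤ) (by rw [abs_of_nonneg (by positivity)]; exact_mod_cast h.2)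
    rw [zpow_natCast] at hp
    exact (R.norm_stored_mul_ofReal_sub_le hμ hp (U h r s)).trans
      (mul_le_mul_of_nonneg_left (hzM h) ha)
  have hzM' : ∀ h, ‖z' h‖ ≤ (1 + μ) ^ 2 * M := fun h => by
    have h1 := norm_add_le (z h) ((z' - z) h)
    rw [Pi.sub_apply, add_sub_cancel] at h1
    have h2 := hzz h
    rw [Pi.sub_apply] at h2
    have := hzM h
    linarith
  have hcard : √(Fintype.card (Fin (2 ^ q)) : ℝ) = √(2 ^ q) := by simp
  have h1 := twoNorm_le_sqrt_card_mul (by positivity) hzM'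
  have h2 := twoNorm_le_sqrt_card_mul (by positivity) hzz
  rw [hcard] at h1 h2
  have h3 := R.twoNorm_fft_sub_dft_perturbed_le hμ (isRootTower_inv isRootTower_dyadicRoot)
    hw.norm_conj_sub_dyadicRoot_inv_le z' z
  have h4 := norm_apply_le_twoNorm (R.fft (fun p j => conj (w p j)) q z' -
    dft (fun p => (dyadicRoot p)⁻¹) q z) k
  have h5 : (R.algV w t (fun h => (U h).map Complex.ofReal) k -
      circulantSpectrum (dyadicRoot q) θ (fun h => (U h).map Complex.ofReal) k) r s =
      (R.fft (fun p j => conj (w p j)) q z' - dft (fun p => (dyadicRoot p)⁻¹) q z) k := by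
    rw [Matrix.sub_apply, Pi.sub_apply, circulantSpectrum, Matrix.sum_apply]
    rfl
  rw [h5]
  refine h4.trans (h3.trans ?_)
  have hs := Real.sqrt_nonneg (2 ^ q : ℝ)
  have e1 := mul_le_mul_of_nonneg_left (mul_le_mul_of_nonneg_left h1 hs) hb
  have e2 := mul_le_mul_of_nonneg_left h2 hs
  rw [← mul_assoc √(2 ^ q : ℝ), hN] at e1 e2
  linarith

/-- Two errors add up: the perturbation of the argument, and the error of `expm`. The latter is
relative to the exponential of the perturbed argument, whose norm is at most one plus the first
error. -/
theorem normInf_expm_sub_exp_le (hμ : 0 ≤ μ) (hm : m ≠ 0) {τ : ℝ} (hτ : 0 ≤ τ)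
    {expm : Matrix (Fin m) (Fin m) ℂ → Matrix (Fin m) (Fin m) ℂ}
    {V V' : Matrix (Fin m) (Fin m) ℂ} (he : R.ExpmAccurateAt τ expm V') {c : ℝ}
    (hV : normInf (V + algebraMap ℂ _ (c : ℂ)) ≤ c) {K : ℝ}
    (hD : normInf (V' - V) ≤ specErr q K μ) :
    normInf (expm V' - NormedSpace.exp V) ≤ expErr q K τ μ := by
  have h1 := normInf_exp_sub_exp_le hm hV V'
  have h0 := normInf_nonneg (V' - V)
  have h2 : normInf (V' - V) * Real.exp (normInf (V' - V)) ≤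
      specErr q K μ * Real.exp (specErr q K μ) :=
    mul_le_mul hD (Real.exp_le_exp.mpr hD) (Real.exp_pos _).le (h0.trans hD)
  have h3 := normInf_exp_le_one hm hV
  have h4 := normInf_le_add_normInf_sub (NormedSpace.exp V') (NormedSpace.exp V)
  have h5 := normInf_sub_le_add (expm V') (NormedSpace.exp V') (NormedSpace.exp V)
  have h6 := mul_le_mul_of_nonneg_left (h4.trans (add_le_add h3 (h1.trans h2)))
    (mul_nonneg hμ hτ)
  have h7 := he.2
  unfold expErr
  linarith

/-- Errors of the inverse transform: `W'` are the computed exponentials, `W` the exact ones. -/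
theorem normInf_fft_div_sub_le (hμ : 0 ≤ μ) (hw : ApproxRoots μ q w)
    {W W' : Fin (2 ^ q) → Matrix (Fin m) (Fin m) ℂ} {L δ : ℝ} (hδ : 0 ≤ δ) (hL0 : 0 ≤ L)
    (hW : ∀ h, normInf (W' h - W h) ≤ δ)
    (hL : ∀ k : Fin (2 ^ q),
      normInf ((2 ^ q : ℂ)⁻¹ • ∑ h : Fin (2 ^ q), dyadicRoot q ^ (k.1 * h.1) • W h) ≤ L)
    (k : Fin (2 ^ q)) :
    normInf ((Matrix.of fun r s => R.fft w q (fun h => W' h r s) k / (2 ^ q : ℂ)) -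
      (2 ^ q : ℂ)⁻¹ • ∑ h : Fin (2 ^ q), dyadicRoot q ^ (k.1 * h.1) • W h) ≤
      m * (fftErr q μ * (√(2 ^ q) * L + δ)) + δ := by
  have hb := fftErr_nonneg q hμ
  have hs := Real.sqrt_nonneg (2 ^ q : ℝ)
  have hN : √(2 ^ q : ℝ) * √(2 ^ q : ℝ) = 2 ^ q := Real.mul_self_sqrt (by positivity)
  have hN0 : (0 : ℝ) < 2 ^ q := by positivity
  have hnorm : ‖(2 ^ q : ℂ)‖ = 2 ^ q := by simp
  have hcard : √(Fintype.card (Fin (2 ^ q)) : ℝ) = √(2 ^ q) := by simp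
  set ρ := dyadicRoot
  have hρ : IsRootTower ρ := isRootTower_dyadicRoot
  have hdft : ∀ (X : Fin (2 ^ q) → Matrix (Fin m) (Fin m) ℂ) (k : Fin (2 ^ q)) r s,
      ((2 ^ q : ℂ)⁻¹ • ∑ h : Fin (2 ^ q), ρ q ^ (k.1 * h.1) • X h) r s =
        dft ρ q (fun h => X h r s) k / 2 ^ q := fun X k r s => by
    rw [Matrix.smul_apply, Matrix.sum_apply, smul_eq_mul, div_eq_inv_mul]; rfl
  set S : Matrix (Fin m) (Fin m) ℂ := Matrix.of fun r s => R.fft w q (fun h => W' h r s) k / 2 ^ q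
  have h1 : normInf (S - (2 ^ q : ℂ)⁻¹ • ∑ h : Fin (2 ^ q), ρ q ^ (k.1 * h.1) • W' h) ≤
      m * (fftErr q μ * (√(2 ^ q) * L + δ)) := by
    refine normInf_le_of_entries_le (by positivity) fun r s => ?_
    set x : Fin (2 ^ q) → ℂ := fun h => W h r s
    set x' : Fin (2 ^ q) → ℂ := fun h => W' h r s
    have e1 := R.twoNorm_fft_sub_dft_le hμ hρ hw.norm_sub_dyadicRoot_le x'
    have e2 : twoNorm (x' - x) ≤ √(2 ^ q) * δ := by
      rw [← hcard]
      exact twoNorm_le_sqrt_card_mul hδ fun h =>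
        (norm_apply_le_normInf (W' h - W h) r s).trans (hW h)
    -- Parseval read backwards: `W` is controlled through its transform, whose entries divided by
    -- `n` are bounded by `L`.
    have e3 : √(2 ^ q) * twoNorm x ≤ √(2 ^ q) * (2 ^ q * L) := by
      rw [← twoNorm_dft hρ]
      conv_rhs => rw [← hcard]
      refine twoNorm_le_sqrt_card_mul (by positivity) fun j => ?_
      have h2 := (norm_apply_le_normInf _ r s).trans (hL j)
      rw [hdft, norm_div, hnorm, div_le_iff₀ hN0] at h2
      linarith
    have e4 : twoNorm x' ≤ twoNorm x + √(2 ^ q) * δ := by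
      have := twoNorm_add_le x (x' - x)
      rw [add_sub_cancel] at this
      linarith
    have e5 : √(2 ^ q) * twoNorm x' ≤ (√(2 ^ q) * L + δ) * 2 ^ q := by
      have := mul_le_mul_of_nonneg_left e4 hs
      have h6 : √(2 ^ q) * (√(2 ^ q) * δ) = 2 ^ q * δ := by rw [← mul_assoc, hN]
      linarith
    have e6 := norm_apply_le_twoNorm (R.fft w q x' - dft ρ q x') k
    rw [Matrix.sub_apply, hdft]
    have e7 : S r s - dft ρ q x' k / 2 ^ q = (R.fft w q x' - dft ρ q x') k / 2 ^ q := by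
      rw [Pi.sub_apply, sub_div]; rfl
    rw [e7, norm_div, hnorm, div_le_iff₀ hN0]
    refine e6.trans (e1.trans ?_)
    have := mul_le_mul_of_nonneg_left e5 hb
    unfold fftErr at this ⊢
    linarith
  have h2 : normInf ((2 ^ q : ℂ)⁻¹ • ∑ h : Fin (2 ^ q), ρ q ^ (k.1 * h.1) • W' h -
      (2 ^ q : ℂ)⁻¹ • ∑ h : Fin (2 ^ q), ρ q ^ (k.1 * h.1) • W h) ≤ δ := by
    rw [← smul_sub, ← Finset.sum_sub_distrib, normInf_smul, norm_inv, hnorm,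
      inv_mul_le_iff₀ hN0]
    refine (normInf_sum_le _ _).trans ?_
    calc ∑ h : Fin (2 ^ q), normInf (ρ q ^ (k.1 * h.1) • W' h - ρ q ^ (k.1 * h.1) • W h)
        ≤ ∑ _h : Fin (2 ^ q), δ := Finset.sum_le_sum fun h _ => by
          rw [← smul_sub, normInf_smul, norm_pow, hρ.norm_eq_one, one_pow, one_mul]
          exact hW h
      _ = 2 ^ q * δ := by simp
  exact (normInf_sub_le_add _ _ _).trans (add_le_add h1 h2)

/-- Division by `2 ^ q` of a matrix of computed transforms. -/
theorem normInf_divReal_fft_sub_le (hμ : 0 ≤ μ) {W' : Fin (2 ^ q) → Matrix (Fin m) (Fin m) ℂ}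
    (hfl : ∀ h r s, R.IsFloat (W' h r s)) (k : Fin (2 ^ q)) :
    normInf ((Matrix.of fun r s => R.divReal (R.fft w q (fun h => W' h r s) k) (2 ^ q)) -
      Matrix.of fun r s => R.fft w q (fun h => W' h r s) k / (2 ^ q : ℂ)) ≤
      (if q = 0 then 0 else 1) * μ *
        normInf (Matrix.of fun r s => R.fft w q (fun h => W' h r s) k / (2 ^ q : ℂ)) := by
  refine normInf_le_mul_of_entries_le (by split_ifs <;> simp [hμ]) fun r s => ?_
  simp only [Matrix.sub_apply, Matrix.of_apply]
  split_ifs with hq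
  -- For length one the transform is the identity, so a floating point number is divided by one and
  -- rounding leaves it unchanged.
  · subst hq
    have h : R.divReal (W' k r s) 1 = W' k r s := R.divReal_one (hfl k r s)
    have h' : R.divReal (R.fft w 0 (fun h => W' h r s) k) (2 ^ 0) = W' k r s := by
      rw [pow_zero (2 : ℝ)]; exact h
    rw [h', pow_zero (2 : ℂ), div_one]
    simp [fft]
  · have := R.norm_divReal_sub_le hμ (R.fft w q (fun h => W' h r s) k) (2 ^ q)
    rw [one_mul]
    simpa using this

/-- Scaling by the stored powers `θ ^ (-k)`. -/
theorem normInf_stored_mul_sub_le (hμ : 0 ≤ μ) {z z' : ℂ} (hz : ‖z' - z‖ ≤ μ * ‖z‖)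
    (A B : Matrix (Fin m) (Fin m) ℂ) :
    normInf ((Matrix.of fun r s => R.mul z' (A r s)) - z • B) ≤
      ‖z‖ * (storedMulErr μ * normInf B + (1 + storedMulErr μ) * normInf (A - B)) := by
  have hβ := storedMulErr_nonneg hμ
  have h1 : normInf ((Matrix.of fun r s => R.mul z' (A r s)) - z • A) ≤
      storedMulErr μ * ‖z‖ * normInf A :=
    normInf_le_mul_of_entries_le (by positivity) fun r s => by
      rw [mul_assoc]; exact R.norm_stored_mul_sub_le hμ hz (A r s)
  have h2 : normInf (z • A - z • B) = ‖z‖ * normInf (A - B) := by rw [← smul_sub, normInf_smul]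
  have h3 := normInf_sub_le_add (Matrix.of fun r s => R.mul z' (A r s)) (z • A) (z • B)
  have h4 := mul_le_mul_of_nonneg_left (normInf_le_add_normInf_sub A B)
    (by positivity : 0 ≤ storedMulErr μ * ‖z‖)
  linarith

end Rounding

theorem norm_inv_pow_le {θ : ℂ} (hθ0 : θ ≠ 0) (hθ : ‖θ‖ ≤ 1) {k n : ℕ} (hk : k ≤ n) :
    ‖θ⁻¹ ^ k‖ ≤ ‖θ ^ n‖⁻¹ := by
  rw [norm_pow, norm_inv, norm_pow, ← inv_pow]
  exact pow_le_pow_right₀ (one_le_inv₀ (norm_pos_iff.mpr hθ0) |>.mpr hθ) hk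

theorem abs_apply_le_iSup {n m : ℕ} (U : Fin n → Matrix (Fin m) (Fin m) ℝ) (h : Fin n)
    (r s : Fin m) : |U h r s| ≤ ⨆ h, ⨆ r, ⨆ s, |U h r s| :=
  (le_ciSup (Set.finite_range fun s => |U h r s|).bddAbove s).trans
    ((le_ciSup (Set.finite_range fun r => ⨆ s, |U h r s|).bddAbove r).trans
      (le_ciSup (Set.finite_range fun h => ⨆ r, ⨆ s, |U h r s|).bddAbove h))

/-- Explicit error bound, with all orders in `μ`. -/
theorem normInf_algY_sub_le {q m : ℕ} (hm : m ≠ 0) {U : Fin (2 ^ q) → Matrix (Fin m) (Fin m) ℝ}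
    (hU : IsSubgenerator (blockToeplitz U)) {θ : ℂ} (hθ0 : θ ≠ 0) (hθ : ‖θ‖ ≤ 1) {τ : ℝ}
    (hτ : 0 ≤ τ) {Y : Fin (2 ^ q) → Matrix (Fin m) (Fin m) ℂ}
    (hY : Y = circulantRow (dyadicRoot q) θ fun h => NormedSpace.exp
      (circulantSpectrum (dyadicRoot q) θ (fun h => (U h).map Complex.ofReal) h))
    {M L : ℝ} (hM0 : 0 ≤ M) (hL0 : 0 ≤ L) (hM : ∀ h r s, |U h r s| ≤ M)
    (hL : ∀ k, normInf (Y k) ≤ L) {μ : ℝ} (hμ : 0 ≤ μ) (R : Rounding μ)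
    {w : ℕ → ℕ → ℂ} {t : ℤ → ℂ} {expm : Matrix (Fin m) (Fin m) ℂ → Matrix (Fin m) (Fin m) ℂ}
    (hw : ApproxRoots μ q w) (ht : ApproxPowers μ (2 ^ q) θ t)
    (he : ∀ h, R.ExpmAccurateAt τ expm (R.algV w t (fun k => (U k).map Complex.ofReal) h))
    (k : Fin (2 ^ q)) :
    normInf (Y k - R.algY w t expm (fun k => (U k).map Complex.ofReal) k) ≤
      ‖θ ^ 2 ^ q‖⁻¹ * outErr q m (m * 2 ^ q * M) τ L (if q = 0 then 0 else 1) μ := by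
  set Uc : Fin (2 ^ q) → Matrix (Fin m) (Fin m) ℂ := fun k => (U k).map Complex.ofReal
  set ρ := dyadicRoot
  set K : ℝ := m * 2 ^ q * M
  have hK0 : 0 ≤ K := by positivity
  set W : Fin (2 ^ q) → Matrix (Fin m) (Fin m) ℂ :=
    fun h => NormedSpace.exp (circulantSpectrum (ρ q) θ Uc h)
  set W' : Fin (2 ^ q) → Matrix (Fin m) (Fin m) ℂ := fun h => expm (R.algV w t Uc h)
  set B : Fin (2 ^ q) → Matrix (Fin m) (Fin m) ℂ :=
    fun k => (2 ^ q : ℂ)⁻¹ • ∑ h : Fin (2 ^ q), ρ q ^ (k.1 * h.1) • W h with hB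
  have hW : ∀ h, normInf (W' h - W h) ≤ expErr q K τ μ := fun h => by
    obtain ⟨c, hc⟩ := hU.exists_normInf_circulantSpectrum_add_le
      (isRootTower_dyadicRoot.norm_eq_one q) hθ h
    exact R.normInf_expm_sub_exp_le hμ hm hτ (he h) hc
      (R.normInf_algV_sub_le hμ hθ hw ht U hM hM0 h)
  have hYB : ∀ k, Y k = θ⁻¹ ^ k.1 • B k := fun k => by
    rw [hY, circulantRow, hB, smul_smul]
    push_cast
    rfl
  have hBL : ∀ k, normInf (B k) ≤ L := fun k => by
    -- Before the final scaling the blocks are no larger than those of `Y`, because `‖θ‖ ≤ 1`.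
    have h1 : B k = θ ^ k.1 • Y k := by
      rw [hYB, smul_smul, ← mul_pow, mul_inv_cancel₀ hθ0, one_pow, one_smul]
    rw [h1, normInf_smul, norm_pow]
    exact (mul_le_of_le_one_left (normInf_nonneg _)
      (pow_le_one₀ (norm_nonneg _) hθ)).trans (hL k)
  have hO := expErr_nonneg q hK0 hτ hμ
  have h1 : normInf (_ - B k) ≤ invErr q m K τ L μ :=
    R.normInf_fft_div_sub_le hμ hw hO hL0 hW hBL k
  have h2 := R.normInf_divReal_fft_sub_le (w := w) hμ (W' := W') (fun h => (he h).1) k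
  set S : Matrix (Fin m) (Fin m) ℂ :=
    Matrix.of fun r s => R.fft w q (fun h => W' h r s) k / (2 ^ q : ℂ)
  set A : Matrix (Fin m) (Fin m) ℂ :=
    Matrix.of fun r s => R.divReal (R.fft w q (fun h => W' h r s) k) (2 ^ q)
  set δ : ℝ := if q = 0 then 0 else 1 with hδ
  have hδ0 : 0 ≤ δ := by rw [hδ]; split_ifs <;> simp
  have h3 : normInf (A - B k) ≤ invErr q m K τ L μ + δ * μ * (L + invErr q m K τ L μ) := by
    have e1 := normInf_sub_le_add A S (B k)
    have e2 := normInf_le_add_normInf_sub S (B k)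
    have e3 := mul_le_mul_of_nonneg_left (e2.trans (add_le_add (hBL k) h1))
      (mul_nonneg hδ0 hμ)
    linarith
  have ht' := ht (-(k.1 : ℤ)) (by
    rw [abs_neg, abs_of_nonneg (by positivity)]; exact_mod_cast k.2)
  rw [zpow_neg, zpow_natCast, ← inv_pow] at ht'
  have h4 := R.normInf_stored_mul_sub_le hμ ht' A (B k)
  rw [← hYB] at h4
  have hβ := storedMulErr_nonneg hμ
  rw [normInf_sub_comm]
  refine (show normInf (R.algY w t expm Uc k - Y k) ≤ _ from h4).trans ?_
  refine mul_le_mul (norm_inv_pow_le hθ0 hθ k.2.le) ?_ ?_ (by positivity)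
  · unfold outErr
    have e1 := mul_le_mul_of_nonneg_left (hBL k) hβ
    have e2 := mul_le_mul_of_nonneg_left h3 (by positivity : 0 ≤ 1 + storedMulErr μ)
    linarith
  · have := normInf_nonneg (B k)
    have := normInf_nonneg (A - B k)
    positivity

theorem theorem2 (q m : ℕ) (U : Fin (2 ^ q) → Matrix (Fin m) (Fin m) ℝ)
    (hU : IsSubgenerator (blockToeplitz U))
    (ε θ : ℂ) (hε₀ : ε ≠ 0) (hε₁ : ‖ε‖ < 1) (hθ : θ ^ (2 ^ q) = ε) (τ : ℝ) (hτ : 0 ≤ τ) :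
    ∃ Y : Fin (2 ^ q) → Matrix (Fin m) (Fin m) ℂ,
      blockEpsCirculant ε Y
        = NormedSpace.exp (blockEpsCirculant ε fun k => (U k).map Complex.ofReal) ∧
      ∃ C > 0, ∃ μ₀ > 0, ∀ μ : ℝ, 0 < μ → μ ≤ μ₀ →
        ∀ (R : Rounding μ) (w : ℕ → ℕ → ℂ) (t : ℤ → ℂ)
          (expm : Matrix (Fin m) (Fin m) ℂ → Matrix (Fin m) (Fin m) ℂ),
          ApproxRoots μ q w →
          ApproxPowers μ (2 ^ q) θ t →
          (∀ h, R.ExpmAccurateAt τ expm (R.algV w t (fun k => (U k).map Complex.ofReal) h)) →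
          ∀ k, normInf (Y k - R.algY w t expm (fun k => (U k).map Complex.ofReal) k)
            ≤ μ * ‖ε‖⁻¹ * m *
                phi m (2 ^ q) (⨆ h, ⨆ r, ⨆ s, |U h r s|) (⨆ h, normInf (Y h)) τ
              + C * μ ^ 2 := by
  subst hθ
  have hθ0 : θ ≠ 0 := fun h => hε₀ (by rw [h, zero_pow (by positivity)])
  have hθ1 : ‖θ‖ ≤ 1 := norm_le_one_of_pow_norm_lt_one hε₁
  refine ⟨_, blockEpsCirculant_exp (isPrimitiveRoot_dyadicRoot q) hθ0 _, ?_⟩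
  set Y := circulantRow (dyadicRoot q) θ fun h => NormedSpace.exp
    (circulantSpectrum (dyadicRoot q) θ (fun h => (U h).map Complex.ofReal) h) with hY
  -- Empty matrices are treated apart: there the identity has norm zero, and the contraction
  -- estimates need norm one.
  rcases Nat.eq_zero_or_pos m with rfl | hm
  · refine ⟨1, one_pos, 1, one_pos, fun μ _ _ R w t expm _ _ _ k => ?_⟩
    have h0 : normInf (Y k - R.algY w t expm (fun k => (U k).map Complex.ofReal) k) ≤ 0 :=
      (normInf_le_iff le_rfl).mpr fun r => r.elim0
    refine h0.trans ?_
    simp only [Nat.cast_zero, mul_zero, zero_mul, zero_add, one_mul]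
    positivity
  set M : ℝ := ⨆ h, ⨆ r, ⨆ s, |U h r s|
  set L : ℝ := ⨆ h, normInf (Y h)
  have hM0 : 0 ≤ M :=
    Real.iSup_nonneg fun _ => Real.iSup_nonneg fun _ => Real.iSup_nonneg fun _ => abs_nonneg _
  have hL0 : 0 ≤ L := Real.iSup_nonneg fun _ => normInf_nonneg _
  have hL : ∀ k, normInf (Y k) ≤ L :=
    le_ciSup (Set.finite_range fun k => normInf (Y k)).bddAbove
  -- `C` is fixed here, before `μ`, the rounding and the stored approximations are introduced.
  obtain ⟨C, hC, hbound⟩ := exists_le_mul_add_sq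
    (contDiff_outErr q m (m * 2 ^ q * M) τ L (if q = 0 then 0 else 1)) (outErr_zero _ _ _ _ _ _)
    (hasDerivAt_outErr _ _ _ _ _ _) (deriv_outErr_le hm.ne' hM0 hτ hL0)
  have hε : 0 < ‖θ ^ 2 ^ q‖⁻¹ := inv_pos.mpr (norm_pos_iff.mpr hε₀)
  refine ⟨‖θ ^ 2 ^ q‖⁻¹ * C, by positivity, 1, one_pos,
    fun μ hμ hμ1 R w t expm hw ht he k => ?_⟩
  have h1 := normInf_algY_sub_le hm.ne' hU hθ0 hθ1 hτ hY hM0 hL0 (abs_apply_le_iSup U) hL hμ.le R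
    hw ht he k
  have h2 := mul_le_mul_of_nonneg_left (hbound μ hμ hμ1) hε.le
  linarith

end
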